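/- Let $X$ be a complex manifold of dimension $d$, let $K_X=\bigwedge^d T^*X$ be (the total space of) its canonical bundle with projection $\pi:K_X\to X$, and let $K_X^\times$ be the complement of the zero section. For a holomorphic chart $w=(w_1,\dots,w_d):U\to\mathbb{C}^d$ of $X$ put $z_w(\eta)=\eta\left(\frac{\partial}{\partial w_1},\dots,\frac{\partial}{\partial w_d}\right)$ for $\eta\in\pi^{-1}(U)$, so that $(z_w,w)$ is a chart on $\pi^{-1}(U)$. Let $\mathbb{C}^\times$ act on $K_X$ by $h\cdot\eta=h^{-1}\eta$ (the left action belonging to the right action by fibrewise scaling), and let the group $\mathrm{Aut}\,X$ of biholomorphic maps of $X$ act on $K_X$ by the inverse transpose of the differential; both actions preserve $K_X^\times$. For a group element $g$ acting on a manifold, write $\Gamma_g\alpha=(g^{-1})^*\alpha$ for forms $\alpha$. Let $\chi_1:\mathbb{C}^\times\to\mathbb{C}^\times$ be the character $\chi_1(h)=h$. There is a well-defined nowhere vanishing holomorphic $(d+1)$-form $\hat\omega$ on $K_X$ (the canonical form) such that for every holomorphic chart $w:U\to\mathbb{C}^d$ of $X$ $$\hat\omega=dz_w\wedge dw_1\wedge\cdots\wedge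 dw_d\quad\text{on }\pi^{-1}(U).$$ It has the following properties. 1. $\Gamma_g\hat\omega=\hat\omega$ for all $g\in\mathrm{Aut}\,X$, and $\Gamma_h\hat\omega=\chi_1(h)\,\hat\omega=h\,\hat\omega$ for all $h\in\mathbb{C}^\times$. 2. $(\hat\omega,\chi_1)$ is an $\mathrm{Aut}\,X$-equivariant CY structure on $K_X^\times$. That is: $K_X^\times\to X$ is a holomorphic principal $\mathbb{C}^\times$-bundle; $\mathrm{Aut}\,X$ acts on $K_X^\times$ by holomorphic maps which commute with $\mathbb{C}^\times$ and cover its action on $X$; and $\hat\omega$ restricts to a nowhere vanishing holomorphic top form on $K_X^\times$ which is invariant under $\mathrm{Aut}\,X$ and satisfies $\Gamma_h\hat\omega=\chi_1(h)\hat\omega$ for $h\in\mathbb{C}^\times$. If moreover a complex Lie group $G$ acts holomorphically on $X$, then the induced action $G\times K_X^\times\to K_X^\times$ is holomorphic, and $(\hat\omega,\chi_1)$ is likewise a $G$-equivariant CY structure on $K_X^\times$. 3. Let $x_0$ be the vector field on $K_X^\times$ generated by $-1\in\mathbb{C}=\mathrm{Lie}(\mathbb{C}^\times)$, i.e. $(x_0)_\eta=\frac{d}{dt}\big|_{t=0}\exp(-t)\cdot\eta$.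 Then $\iota_{x_0}\hat\omega$ is an $\mathrm{Aut}\,X$-invariant holomorphic $d$-form on $K_X^\times$ which is $\mathbb{C}^\times$-horizontal, i.e. its contraction with every vector field generated by an element of $\mathrm{Lie}(\mathbb{C}^\times)$ is zero. For every holomorphic chart $w:U\to\mathbb{C}^d$ of $X$, $$\iota_{x_0}\hat\omega=z_w\,dw_1\wedge\cdots\wedge dw_d\quad\text{on }\pi^{-1}(U)\cap K_X^\times.$$ -/

import Mathlib

open Bundle Set
open scoped Manifold Topology Bundle ContDiff

namespace Calabi

noncomputable section

/-! ### The bundle of alternating forms is as regular as the bundles it is made of -/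

section AlternatingBundle

variable {𝕜 : Type*} [NontriviallyNormedField 𝕜] {ι : Type*} [Fintype ι] [DecidableEq ι]
  {E F G : Type*} [NormedAddCommGroup E] [NormedSpace 𝕜 E] [NormedAddCommGroup F]
  [NormedSpace 𝕜 F] [NormedAddCommGroup G] [NormedSpace 𝕜 G]

/-- Alternatization as a continuous linear map. -/
def alternatizationCLM :
    ContinuousMultilinearMap 𝕜 (fun _ : ι => E) G →L[𝕜] E [⋀^ι]→L[𝕜] G where
  toFun := ContinuousMultilinearMap.alternatization
  map_add' := map_add _
  map_smul' c f := by
    ext v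
    simp only [ContinuousMultilinearMap.alternatization_apply_apply, RingHom.id_apply,
      smul_apply, ContinuousAlternatingMap.smul_apply, Finset.smul_sum]
    exact Finset.sum_congr rfl fun σ _ => smul_comm _ _ _
  cont := by
    rw [ContinuousAlternatingMap.isEmbedding_toContinuousMultilinearMap.continuous_iff]
    have : (ContinuousAlternatingMap.toContinuousMultilinearMap ∘
          (ContinuousMultilinearMap.alternatization :
            ContinuousMultilinearMap 𝕜 (fun _ : ι => E) G → E [⋀^ι]→L[𝕜] G)) =
        fun f => ∑ σ : Equiv.Perm ι, (Equiv.Perm.sign σ : ℤ) •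
          ContinuousMultilinearMap.domDomCongrₗᵢ 𝕜 E G σ f := by
      ext f v
      simp [ContinuousMultilinearMap.alternatization_apply_apply, Function.comp_def,
        ContinuousMultilinearMap.domDomCongrₗᵢ, Units.smul_def]
    rw [this]
    exact continuous_finsetSum _ fun σ _ =>
      ((ContinuousMultilinearMap.domDomCongrₗᵢ 𝕜 E G σ).continuous).const_smul
        (Equiv.Perm.sign σ : ℤ)

theorem contDiff_compContinuousLinearMapCLM [CharZero 𝕜] {n : ℕ∞ω} :
    ContDiff 𝕜 n (ContinuousAlternatingMap.compContinuousLinearMapCLM :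
      (E →L[𝕜] F) → (F [⋀^ι]→L[𝕜] G) →L[𝕜] (E [⋀^ι]→L[𝕜] G)) := by
  have : (ContinuousAlternatingMap.compContinuousLinearMapCLM :
      (E →L[𝕜] F) → (F [⋀^ι]→L[𝕜] G) →L[𝕜] (E [⋀^ι]→L[𝕜] G)) = fun A =>
      ((Fintype.card ι).factorial : 𝕜)⁻¹ •
        ((alternatizationCLM (𝕜 := 𝕜) (ι := ι) (E := E) (G := G)) ∘L
        (ContinuousMultilinearMap.compContinuousLinearMapContinuousMultilinear 𝕜
          (fun _ : ι => E) (fun _ => F) G (fun _ => A)) ∘L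
        (ContinuousAlternatingMap.toContinuousMultilinearMapCLM 𝕜)) := by
    ext A f v
    have hn : ((Fintype.card ι).factorial : 𝕜) ≠ 0 :=
      Nat.cast_ne_zero.2 (Nat.factorial_ne_zero _)
    have key : ∀ σ : Equiv.Perm ι, Equiv.Perm.sign σ • f (fun i => A (v (σ i))) =
        f (fun i => A (v i)) := fun σ => by
      have := f.toAlternatingMap.map_perm (fun i => A (v i)) σ
      simp only [Function.comp_def, ContinuousAlternatingMap.coe_toAlternatingMap] at this
      rw [this, smul_smul]
      simp
    simp [alternatizationCLM, ContinuousMultilinearMap.alternatization_apply_apply,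
      Function.comp_def, key]
    rw [Fintype.card_perm, ← Nat.cast_smul_eq_nsmul 𝕜, smul_smul, inv_mul_cancel₀ hn, one_smul]
  rw [this]
  refine ContDiff.const_smul _ ?_
  refine contDiff_const.clm_comp (ContDiff.clm_comp ?_ contDiff_const)
  exact (ContinuousMultilinearMap.contDiff _).comp (contDiff_pi.2 fun _ => contDiff_id)

end AlternatingBundle

section AlternatingBundleRegularity

open Bundle.Pretrivialization

variable {𝕜 ι : Type*} [NontriviallyNormedField 𝕜] [CharZero 𝕜] [Fintype ι] [DecidableEq ι]
  {B : Type*} [TopologicalSpace B]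
  {EB : Type*} [NormedAddCommGroup EB] [NormedSpace 𝕜 EB] {HB : Type*} [TopologicalSpace HB]
  {IB : ModelWithCorners 𝕜 EB HB} [ChartedSpace HB B] {n : ℕ∞ω}
  {F₁ : Type*} [NormedAddCommGroup F₁] [NormedSpace 𝕜 F₁] {E₁ : B → Type*}
  [∀ x, AddCommGroup (E₁ x)] [∀ x, Module 𝕜 (E₁ x)] [TopologicalSpace (TotalSpace F₁ E₁)]
  [∀ x, TopologicalSpace (E₁ x)] [FiberBundle F₁ E₁] [VectorBundle 𝕜 F₁ E₁]
  [ContMDiffVectorBundle n F₁ E₁ IB]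
  {F₂ : Type*} [NormedAddCommGroup F₂] [NormedSpace 𝕜 F₂] {E₂ : B → Type*}
  [∀ x, AddCommGroup (E₂ x)] [∀ x, Module 𝕜 (E₂ x)] [TopologicalSpace (TotalSpace F₂ E₂)]
  [∀ x, TopologicalSpace (E₂ x)] [FiberBundle F₂ E₂] [VectorBundle 𝕜 F₂ E₂]
  [ContMDiffVectorBundle n F₂ E₂ IB]
  [∀ x, IsTopologicalAddGroup (E₂ x)] [∀ x, ContinuousSMul 𝕜 (E₂ x)]

instance alternatingVectorPrebundle_isContMDiff :
    (Bundle.ContinuousAlternatingMap.vectorPrebundle 𝕜 ι F₁ E₁ F₂ E₂).IsContMDiff IB n where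
  exists_contMDiffCoordChange := by
    rintro _ ⟨e₁, e₂, he₁, he₂, rfl⟩ _ ⟨e₁', e₂', he₁', he₂', rfl⟩
    refine ⟨continuousAlternatingMapCoordChange 𝕜 ι e₁ e₁' e₂ e₂', ?_,
      continuousAlternatingMapCoordChange_apply⟩
    have h₁ := contMDiffOn_coordChangeL (IB := IB) e₁' e₁ (n := n)
    have h₂ := contMDiffOn_coordChangeL (IB := IB) e₂ e₂' (n := n)
    simp +unfoldPartialApp only [continuousAlternatingMapCoordChange,
      ContinuousLinearEquiv.coe_continuousAlternatingMapCongr, ContinuousLinearEquiv.symm_symm]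
    refine ContMDiffOn.clm_comp ?_ ?_
    · exact (ContinuousLinearMap.contDiff _).contMDiff.comp_contMDiffOn
        (h₂.mono fun b hb => ⟨hb.1.2, hb.2.2⟩)
    · exact contDiff_compContinuousLinearMapCLM.contMDiff.comp_contMDiffOn
        (h₁.mono fun b hb => ⟨hb.2.1, hb.1.1⟩)

/-- The bundle of alternating maps between two vector bundles of class `C^n` is of class `C^n`. -/
instance contMDiffVectorBundle_alternating :
    ContMDiffVectorBundle n (F₁ [⋀^ι]→L[𝕜] F₂) (fun b : B => E₁ b [⋀^ι]→L[𝕜] E₂ b) IB :=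
  (Bundle.ContinuousAlternatingMap.vectorPrebundle 𝕜 ι F₁ E₁ F₂ E₂).contMDiffVectorBundle IB

end AlternatingBundleRegularity

/-! ### Differential forms on complex manifolds -/

section LinearAlgebra

variable {V : Type*} [AddCommGroup V] [Module ℂ V] [TopologicalSpace V] {k : ℕ}

/-- The wedge product `α₀ ∧ ⋯ ∧ α_{k-1}` of covectors, with value `det (αᵢ (vⱼ))` on
`(v₀, …, v_{k-1})`. -/
def wedge (α : Fin k → V →L[ℂ] ℂ) : V [⋀^Fin k]→L[ℂ] ℂ :=
  ContinuousMultilinearMap.alternatization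
    ((ContinuousMultilinearMap.mkPiAlgebra ℂ (Fin k) ℂ).compContinuousLinearMap α)

theorem wedge_apply (α : Fin k → V →L[ℂ] ℂ) (v : Fin k → V) :
    wedge α v = Matrix.det (Matrix.of fun i j => α i (v j)) := by
  rw [wedge, ContinuousMultilinearMap.alternatization_apply_apply, ← Matrix.det_transpose,
    Matrix.det_apply]
  simp

/-- The contraction `f (v, ·, …, ·)` of an alternating form with a vector in the first slot. -/
def contractVec (v : V) (f : V [⋀^Fin (k + 1)]→L[ℂ] ℂ) : V [⋀^Fin k]→L[ℂ] ℂ where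
  toMultilinearMap := (f.toAlternatingMap.curryLeft v).toMultilinearMap
  cont := f.cont.comp (by
    refine continuous_pi fun i => ?_
    refine Fin.cases ?_ (fun j => ?_) i
    · exact continuous_const
    · exact continuous_apply j)
  map_eq_zero_of_eq' := (f.toAlternatingMap.curryLeft v).map_eq_zero_of_eq'

end LinearAlgebra

section Forms

variable {E H : Type*} [NormedAddCommGroup E] [NormedSpace ℂ E] [TopologicalSpace H]
  (I : ModelWithCorners ℂ E H) {M : Type*} [TopologicalSpace M] [ChartedSpace H M]
  {E' H' : Type*} [NormedAddCommGroup E'] [NormedSpace ℂ E'] [TopologicalSpace H']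
  (I' : ModelWithCorners ℂ E' H') {M' : Type*} [TopologicalSpace M'] [ChartedSpace H' M']
  {k : ℕ}

/-- The model fibre of the bundle of `(k, 0)`-forms. -/
abbrev FormModel (E : Type*) [NormedAddCommGroup E] [NormedSpace ℂ E] (k : ℕ) : Type _ :=
  E [⋀^Fin k]→L[ℂ] ℂ

/-- The fibre at `x` of the bundle of `(k, 0)`-forms: complex `k`-linear alternating forms on the
holomorphic tangent space. -/
abbrev FormFiber (k : ℕ) (x : M) : Type _ :=
  TangentSpace I x [⋀^Fin k]→L[ℂ] Bundle.Trivial M ℂ x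

/-- Forms of type `(k, 0)`, without regularity. -/
abbrev DForm (M : Type*) [TopologicalSpace M] [ChartedSpace H M] (k : ℕ) : Type _ :=
  ∀ x : M, FormFiber I k x

/-- The form is a holomorphic section of the bundle of `k`-forms. -/
def IsHolomorphicForm [IsManifold I 1 M] (η : DForm I M k) : Prop :=
  ContMDiff I (I.prod 𝓘(ℂ, FormModel E k)) ω
    (fun x => (TotalSpace.mk' (FormModel E k) x (η x) :
      TotalSpace (FormModel E k) (fun x : M => FormFiber I k x)))

/-- Pull-back `f^* η`. -/
def pullback (f : M → M') (η : DForm I' M' k) : DForm I M k :=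
  fun x => (η (f x)).compContinuousLinearMap (mfderiv I I' f x)

/-- Interior multiplication `ι_v η` by a vector field. -/
def contract (v : ∀ x : M, TangentSpace I x) (η : DForm I M (k + 1)) : DForm I M k :=
  fun x => contractVec (v x) (η x)

/-- The form `df₀ ∧ ⋯ ∧ df_{k-1}`. -/
def dWedge (f : Fin k → M → ℂ) : DForm I M k :=
  fun x => wedge fun i => mvfderiv I (f i) x

/-- The action `Γ_g η = (g⁻¹)^* η` on forms which is induced by an action of a group on `M`, i.e.
`g ∘ η ∘ g⁻¹` with `g` acting on forms by the inverse transpose of its differential. -/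
def Γ {G : Type*} [Group G] (act : G → M → M) (g : G) (η : DForm I M k) : DForm I M k :=
  pullback I I (act g⁻¹) η

/-- `exp z` as an element of `ℂˣ`; this is the exponential map `ℂ = Lie(ℂˣ) → ℂˣ`. -/
def expUnit (z : ℂ) : ℂˣ := Units.mk0 (Complex.exp z) (Complex.exp_ne_zero z)

/-- The vector field generated by `a ∈ ℂ = Lie(ℂˣ)`, at `m` the velocity of the curve
`t ↦ exp (t a) · m` at `t = 0`. (For an action, the curve passes through `m` at `t = 0`.) -/
def generatedField (act : ℂˣ → M → M) (a : ℂ) (m : M) : TangentSpace I m :=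
  mfderiv 𝓘(ℂ, ℂ) I (fun t : ℂ => act (expUnit (t * a)) m) 0 (1 : ℂ)

end Forms

/-! ### Principal bundles and CY structures -/

section Principal

variable {EM HM : Type*} [NormedAddCommGroup EM] [NormedSpace ℂ EM] [TopologicalSpace HM]
  (IM : ModelWithCorners ℂ EM HM) {M : Type*} [TopologicalSpace M] [ChartedSpace HM M]
  {EX HX : Type*} [NormedAddCommGroup EX] [NormedSpace ℂ EX] [TopologicalSpace HX]
  (IX : ModelWithCorners ℂ EX HX) {X : Type*} [TopologicalSpace X] [ChartedSpace HX X]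
  {EH HH : Type*} [NormedAddCommGroup EH] [NormedSpace ℂ EH] [TopologicalSpace HH]
  (IH : ModelWithCorners ℂ EH HH) {H : Type*} [TopologicalSpace H] [ChartedSpace HH H] [Group H]
  {G : Type*} [Group G]

/-- A holomorphic (left) action of the complex Lie group `H` on `M`. -/
structure IsHolomorphicAction (act : H → M → M) : Prop where
  one_act : ∀ m, act 1 m = m
  mul_act : ∀ h h' m, act (h * h') m = act h (act h' m)
  holomorphic : ContMDiff (IH.prod IM) IM ω fun p : H × M => act p.1 p.2

/-- `pr : M → X` is a holomorphic principal `H`-bundle. The right action of `H` is recorded through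
the left action `act h m = m h⁻¹`. -/
structure IsPrincipalBundle (pr : M → X) (act : H → M → M) : Prop where
  action : IsHolomorphicAction IM IH act
  holomorphic_proj : ContMDiff IM IX ω pr
  proj_act : ∀ h m, pr (act h m) = pr m
  locally_trivial : ∀ x : X, ∃ (U : Set X) (Φ : OpenPartialHomeomorph M (X × H)),
    IsOpen U ∧ x ∈ U ∧ Φ.source = pr ⁻¹' U ∧ Φ.target = U ×ˢ univ ∧
    ContMDiffOn IM (IX.prod IH) ω Φ Φ.source ∧
    ContMDiffOn (IX.prod IH) IM ω Φ.symm Φ.target ∧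
    (∀ m ∈ Φ.source, (Φ m).1 = pr m) ∧
    ∀ m ∈ Φ.source, ∀ h : H, (Φ (act h m)).2 = (Φ m).2 * h⁻¹

/-- A principal `H`-bundle on which the group `G` acts by holomorphic bundle automorphisms that
commute with `H` and cover the given maps of `X`. -/
structure IsEquivariantPrincipalBundle (pr : M → X) (act : H → M → M)
    (actG : G → M → M) (actX : G → X → X) : Prop where
  principal : IsPrincipalBundle IM IX IH pr act
  one_act : ∀ m, actG 1 m = m
  mul_act : ∀ g g' m, actG (g * g') m = actG g (actG g' m)
  holomorphic_act : ∀ g, ContMDiff IM IM ω (actG g)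
  comm : ∀ g h m, actG g (act h m) = act h (actG g m)
  proj_actG : ∀ g m, pr (actG g m) = actX g (pr m)

/-- `(η, χ)` is a CY structure of the principal `H`-bundle with total space `M`: `η` is a nowhere
vanishing holomorphic top form on `M`, and `χ` is a holomorphic character of `H` such that
`Γ_h η = χ(h) η`. -/
structure IsCYStructure [IsManifold IM 1 M] {k : ℕ} (act : H → M → M) (η : DForm IM M k)
    (χ : H →* ℂˣ) : Prop where
  top_degree : Module.finrank ℂ EM = k
  holomorphic : IsHolomorphicForm IM η
  nowhere_zero : ∀ m, η m ≠ 0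
  holomorphic_character : ContMDiff IH 𝓘(ℂ, ℂ) ω χ
  transform : ∀ h, Γ IM act h η = fun m => (χ h : ℂ) • η m

/-- A CY structure of a `G`-equivariant principal `H`-bundle whose form is invariant under `G`. -/
structure IsEquivariantCYStructure [IsManifold IM 1 M] {k : ℕ} (pr : M → X) (act : H → M → M)
    (actG : G → M → M) (actX : G → X → X) (η : DForm IM M k) (χ : H →* ℂˣ) : Prop where
  bundle : IsEquivariantPrincipalBundle IM IX IH pr act actG actX
  cy : IsCYStructure IM IH act η χ
  invariant : ∀ g : G, Γ IM actG g η = η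

end Principal

/-! ### The canonical bundle and its canonical form -/

section Canonical

variable (d : ℕ) (X : Type*) [TopologicalSpace X] [ChartedSpace (Fin d → ℂ) X]
  [IsManifold 𝓘(ℂ, Fin d → ℂ) ω X]

/-- The total space of the canonical bundle `K_X` of a complex manifold of dimension `d`. -/
abbrev CanonicalBundle : Type _ :=
  TotalSpace (FormModel (Fin d → ℂ) d) (fun x : X => FormFiber 𝓘(ℂ, Fin d → ℂ) d x)

/-- The model with corners of the `(d + 1)`-dimensional complex manifold `K_X`. -/
abbrev IK : ModelWithCorners ℂ ((Fin d → ℂ) × FormModel (Fin d → ℂ) d)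
    (ModelProd (Fin d → ℂ) (FormModel (Fin d → ℂ) d)) :=
  𝓘(ℂ, Fin d → ℂ).prod 𝓘(ℂ, FormModel (Fin d → ℂ) d)

instance isManifold_canonicalBundle : IsManifold (IK d) ω (CanonicalBundle d X) :=
  Bundle.TotalSpace.isManifold _ _

theorem isOpen_ne_zero : IsOpen {η : CanonicalBundle d X | η.2 ≠ 0} := by
  rw [isOpen_iff_mem_nhds]
  intro η hη
  let e := trivializationAt (FormModel (Fin d → ℂ) d)
    (fun x : X => FormFiber 𝓘(ℂ, Fin d → ℂ) d x) η.1
  have hb : η.1 ∈ e.baseSet := FiberBundle.mem_baseSet_trivializationAt' η.1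
  have hs : η ∈ e.source := e.mem_source.2 hb
  have hne : (e η).2 ≠ 0 := fun h0 => hη <| by
    have h1 : e.continuousLinearEquivAt ℂ η.1 hb η.2 = 0 := h0
    exact (e.continuousLinearEquivAt ℂ η.1 hb).map_eq_zero_iff.1 h1
  have hc : ContinuousAt (fun ζ => (e ζ).2) η := (e.continuousAt hs).snd
  filter_upwards [e.open_source.mem_nhds hs, hc.eventually_ne hne] with ζ hζ h hz
  apply h
  have hb' : ζ.1 ∈ e.baseSet := e.mem_source.1 hζ
  have h2 : e.continuousLinearEquivAt ℂ ζ.1 hb' ζ.2 = 0 := by rw [hz]; exact map_zero _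
  exact h2

/-- `K_X^×`, the complement of the zero section in `K_X`. -/
def KX : TopologicalSpace.Opens (CanonicalBundle d X) := ⟨{η | η.2 ≠ 0}, isOpen_ne_zero d X⟩

/-- The group `Aut X` of biholomorphic maps of `X` onto itself. -/
abbrev AutX : Type _ := Diffeomorph 𝓘(ℂ, Fin d → ℂ) 𝓘(ℂ, Fin d → ℂ) X X ω

instance : Group (AutX d X) where
  mul g g' := g'.trans g
  one := Diffeomorph.refl _ _ _
  inv g := g.symm
  mul_assoc _ _ _ := rfl
  one_mul _ := rfl
  mul_one _ := rfl
  inv_mul_cancel g := Diffeomorph.self_trans_symm g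

variable {d X}

/-- The projection `K_X^× → X`. -/
def projKX (η : KX d X) : X := η.1.1

/-- The action `h · η = η h⁻¹` of `ℂˣ` on `K_X`, where `η h = h η` is fibrewise scaling. -/
def actK (h : ℂˣ) (η : CanonicalBundle d X) : CanonicalBundle d X :=
  ⟨η.1, ((h⁻¹ : ℂˣ) : ℂ) • η.2⟩

/-- The action `h · η = η h⁻¹` of `ℂˣ` on `K_X^×`. -/
def actKX (h : ℂˣ) (η : KX d X) : KX d X :=
  ⟨actK h η.1, smul_ne_zero (Units.ne_zero _) η.2⟩

/-- The action of `Aut X` on `K_X` by the inverse transpose of the differential. -/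
def autK (g : AutX d X) (η : CanonicalBundle d X) : CanonicalBundle d X :=
  ⟨g η.1, η.2.compContinuousLinearMap
    (mfderiv 𝓘(ℂ, Fin d → ℂ) 𝓘(ℂ, Fin d → ℂ) g η.1).inverse⟩

theorem autK_ne_zero (g : AutX d X) (η : KX d X) : (autK g η.1).2 ≠ 0 := by
  intro h0
  apply η.2
  let A := g.mfderivToContinuousLinearEquiv (by simp) η.1.1
  have hA : (mfderiv 𝓘(ℂ, Fin d → ℂ) 𝓘(ℂ, Fin d → ℂ) g η.1.1).inverse = A.symm :=
    ContinuousLinearMap.inverse_equiv A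
  change η.1.2.compContinuousLinearMap _ = 0 at h0
  rw [hA] at h0
  ext v
  have h1 := congrArg (fun f => f fun i => A (v i)) h0
  simpa [Function.comp_def] using h1

/-- The action of `Aut X` on `K_X^×`. -/
def autKX (g : AutX d X) (η : KX d X) : KX d X := ⟨autK g η.1, autK_ne_zero g η⟩

/-- The coordinate vector field `∂/∂wᵢ` of a chart `w`. -/
def coordVec (w : OpenPartialHomeomorph X (Fin d → ℂ)) (i : Fin d) (x : X) :
    TangentSpace 𝓘(ℂ, Fin d → ℂ) x :=
  (mfderiv 𝓘(ℂ, Fin d → ℂ) 𝓘(ℂ, Fin d → ℂ) w x).inverse (Pi.single i (1 : ℂ) : Fin d → ℂ)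

/-- The fibre coordinate `z_w(η) = η(∂/∂w₁, …, ∂/∂w_d)` on `K_X` over the domain of `w`. -/
def fibreCoord (w : OpenPartialHomeomorph X (Fin d → ℂ)) (η : CanonicalBundle d X) : ℂ :=
  η.2 fun i => coordVec w i η.1

/-- The form `dz_w ∧ dw₁ ∧ ⋯ ∧ dw_d` on `K_X` over the domain of `w`. -/
def localForm (w : OpenPartialHomeomorph X (Fin d → ℂ)) :
    DForm (IK d) (CanonicalBundle d X) (d + 1) :=
  dWedge (IK d) (Fin.cons (fibreCoord w) fun i η => w η.1 i)

/-- The canonical form `ω̂` of `K_X`: on the fibre of `K_X` at `x`, its value is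
`dz_w ∧ dw₁ ∧ ⋯ ∧ dw_d`, with `w` the preferred chart at `x` (every other holomorphic chart around
`x` gives the same value). -/
def canonicalForm : DForm (IK d) (CanonicalBundle d X) (d + 1) :=
  fun η => localForm (chartAt (Fin d → ℂ) η.1) η

/-- The restriction of the canonical form to `K_X^×`. -/
def canonicalFormKX : DForm (IK d) (KX d X) (d + 1) :=
  pullback (IK d) (IK d) (Subtype.val : KX d X → CanonicalBundle d X) canonicalForm

/-- The vector field on `K_X^×` generated by `-1 ∈ ℂ = Lie(ℂˣ)`. -/
def x₀ (η : KX d X) : TangentSpace (IK d) η := generatedField (IK d) actKX (-1) η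

end Canonical

end

end Calabi

open Calabi

/-! Top forms on `ℂ^d` form a line, so two fibre coordinates differ by a determinant depending only
on the base point: `z_{w'} = J z_w` with `J = det (dw ∘ dw'⁻¹)` (`fibreCoord_eq_mul`).
Differentiating gives `dz_{w'} = J dz_w + z_w dJ`. The last term is a combination of the `dw_j`, and
the `dw'_i` are related to the `dw_j` by a matrix of determinant `J⁻¹`. The change of covectors is
thus block triangular of determinant one and leaves `dz_w ∧ dw₁ ∧ ⋯ ∧ dw_d` unchanged
(`wedge_cons_eq`, `canonicalForm_eq_localForm`).

The rest is read off in a chart. Holomorphy and nonvanishing hold because `(z_w, w)` are holomorphic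
coordinates on `K_X`. An automorphism `g` pulls `(z_w, w)` back to the same data for the chart `w ∘
g`, so invariance is again chart independence. Scaling multiplies `z_w` by a constant and fixes `w`.
Along an orbit of `ℂˣ` the base coordinates are constant and `z_w` is exponential, so contraction
with `x₀` leaves `z_w dw₁ ∧ ⋯ ∧ dw_d`. Holomorphy, invariance and horizontality of the contraction
follow from this formula.

The analytic input is `contMDiffAt_apply_frame`: evaluating forms on the frames of a holomorphic
family of local coordinates is holomorphic, since inversion of operators is analytic. A constant
family gives holomorphy of `z_w`; the family `φ ∘ g n` gives joint holomorphy of a group action on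
`K_X`. -/

namespace Calabi

noncomputable section

/-! ### Linear algebra of wedge products of covectors -/

section LinearAlgebra

variable {V W : Type*} [AddCommGroup V] [Module ℂ V] [TopologicalSpace V]
  [AddCommGroup W] [Module ℂ W] [TopologicalSpace W] {k : ℕ}

/-- Evaluated on vectors this is multiplicativity of the determinant. -/
theorem wedge_sum_smul [IsTopologicalAddGroup V] [ContinuousSMul ℂ V]
    (N : Matrix (Fin k) (Fin k) ℂ) (α : Fin k → V →L[ℂ] ℂ) :
    wedge (fun i => ∑ j, N i j • α j) = N.det • wedge α := by
  ext v
  rw [wedge_apply, ContinuousAlternatingMap.smul_apply, wedge_apply, smul_eq_mul,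
    ← Matrix.det_mul]
  congr 1
  ext i j
  simp [Matrix.mul_apply]

theorem wedge_compContinuousLinearMap (α : Fin k → V →L[ℂ] ℂ) (A : W →L[ℂ] V) :
    (wedge α).compContinuousLinearMap A = wedge fun i => (α i).comp A := by
  ext v
  rw [ContinuousAlternatingMap.compContinuousLinearMap_apply, wedge_apply, wedge_apply]
  rfl

theorem wedge_ne_zero {α : Fin k → V →L[ℂ] ℂ} (v : Fin k → V)
    (h : ∀ i j, α i (v j) = (1 : Matrix (Fin k) (Fin k) ℂ) i j) : wedge α ≠ 0 := by
  intro h0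
  have h1 := congrArg (fun f => f v) h0
  have h2 : (Matrix.of fun i j => α i (v j)) = 1 := by
    ext i j
    exact h i j
  simp only [wedge_apply, h2] at h1
  simp at h1

theorem compContinuousLinearMap_ne_zero {f : V [⋀^Fin k]→L[ℂ] ℂ} (hf : f ≠ 0) {A : W →L[ℂ] V}
    (hA : Function.Surjective A) : f.compContinuousLinearMap A ≠ 0 := by
  intro h0
  apply hf
  ext v
  choose u hu using fun i => hA (v i)
  have h1 := congrArg (fun f => f u) h0
  simpa [Function.comp_def, hu] using h1

theorem contractVec_apply (v : V) (f : V [⋀^Fin (k + 1)]→L[ℂ] ℂ) (u : Fin k → V) :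
    contractVec v f u = f (Matrix.vecCons v u) := rfl

/-- Contracting `α₀ ∧ ⋯ ∧ α_k` with a vector on which all `αᵢ`, `i ≥ 1`, vanish. -/
theorem contractVec_wedge_cons (β : V →L[ℂ] ℂ) (α : Fin k → V →L[ℂ] ℂ) (v : V)
    (hv : ∀ i, α i v = 0) :
    contractVec v (wedge (Fin.cons β α : Fin (k + 1) → V →L[ℂ] ℂ)) = β v • wedge α := by
  ext u
  rw [contractVec_apply, ContinuousAlternatingMap.smul_apply, wedge_apply, wedge_apply,
    Matrix.det_succ_column_zero, Fin.sum_univ_succ]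
  simp only [Matrix.of_apply, Fin.cons_succ, Matrix.cons_val_zero, hv]
  simp only [Fin.val_zero, pow_zero, one_mul, mul_zero, zero_mul, Finset.sum_const_zero, add_zero,
    smul_eq_mul, Fin.cons_zero]
  congr 1

theorem wedge_apply_eq_zero {α : Fin k → V →L[ℂ] ℂ} {v : Fin k → V} (j : Fin k)
    (h : ∀ i, α i (v j) = 0) : wedge α v = 0 := by
  rw [wedge_apply]
  exact Matrix.det_eq_zero_of_column_eq_zero j h

end LinearAlgebra

/-! ### Top degree forms on `ℂ^d` -/

section Volume

variable (d : ℕ)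

/-- The standard volume form of `ℂ^d`. -/
def stdVol : FormModel (Fin d → ℂ) d :=
  wedge fun i => ContinuousLinearMap.proj (R := ℂ) (φ := fun _ : Fin d => ℂ) i

theorem stdVol_single : stdVol d (fun i => Pi.single i (1 : ℂ)) = 1 := by
  rw [stdVol, wedge_apply]
  convert Matrix.det_one (n := Fin d) (R := ℂ)
  ext i j
  simp [Matrix.one_apply, Pi.single_apply]

variable {d}

theorem formModel_ext {f g : FormModel (Fin d → ℂ) d}
    (h : f (fun i => Pi.single i (1 : ℂ)) = g (fun i => Pi.single i (1 : ℂ))) : f = g := by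
  apply ContinuousAlternatingMap.toAlternatingMap_injective
  refine (Pi.basisFun ℂ (Fin d)).ext_alternating fun v hv => ?_
  -- An injective family of basis indices is a permutation, and it changes both forms by the same
  -- sign.
  let σ : Equiv.Perm (Fin d) := Equiv.ofBijective v (Finite.injective_iff_bijective.1 hv)
  have hσ : (fun i => Pi.basisFun ℂ (Fin d) (v i)) =
      (fun i => (Pi.single i (1 : ℂ) : Fin d → ℂ)) ∘ σ := by
    funext i
    simp [σ]
  rw [hσ, AlternatingMap.map_perm, AlternatingMap.map_perm]
  exact congrArg _ h

variable (d) in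
/-- Top degree forms on `ℂ^d` are determined by their value on the standard basis. -/
def evalStd : FormModel (Fin d → ℂ) d ≃ₗ[ℂ] ℂ where
  toFun f := f fun i => Pi.single i (1 : ℂ)
  map_add' _ _ := rfl
  map_smul' _ _ := rfl
  invFun c := c • stdVol d
  left_inv f := formModel_ext (by
    rw [ContinuousAlternatingMap.smul_apply, stdVol_single, smul_eq_mul, mul_one])
  right_inv c := by
    change (c • stdVol d) (fun i => Pi.single i (1 : ℂ)) = c
    rw [ContinuousAlternatingMap.smul_apply, stdVol_single, smul_eq_mul, mul_one]

theorem eval_smul_stdVol (f : FormModel (Fin d → ℂ) d) :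
    f (fun i => Pi.single i (1 : ℂ)) • stdVol d = f := (evalStd d).left_inv f

instance finiteDimensional_formModel : FiniteDimensional ℂ (FormModel (Fin d → ℂ) d) :=
  Module.Finite.equiv (evalStd d).symm

theorem finrank_formModel : Module.finrank ℂ (FormModel (Fin d → ℂ) d) = 1 :=
  (evalStd d).finrank_eq.trans (Module.finrank_self ℂ)

/-- The value of a top degree form on the images of the standard basis is multiplied by the
determinant. -/
theorem formModel_apply_eq_det (f : FormModel (Fin d → ℂ) d) (A : (Fin d → ℂ) →L[ℂ] (Fin d → ℂ)) :
    f (fun i => A (Pi.single i (1 : ℂ))) =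
      A.toLinearMap.det * f (fun i => Pi.single i (1 : ℂ)) := by
  conv_lhs => rw [← eval_smul_stdVol f]
  rw [ContinuousAlternatingMap.smul_apply, smul_eq_mul, mul_comm]
  congr 1
  rw [stdVol, wedge_apply, ← LinearMap.det_toMatrix']
  congr 1

end Volume

/-! ### Pull-back and holomorphy of wedges of differentials -/

section Forms

variable {E H : Type*} [NormedAddCommGroup E] [NormedSpace ℂ E] [TopologicalSpace H]
  {I : ModelWithCorners ℂ E H} {M : Type*} [TopologicalSpace M] [ChartedSpace H M]
  {E' H' : Type*} [NormedAddCommGroup E'] [NormedSpace ℂ E'] [TopologicalSpace H']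
  {I' : ModelWithCorners ℂ E' H'} {M' : Type*} [TopologicalSpace M'] [ChartedSpace H' M']
  {k : ℕ}

theorem pullback_dWedge {φ : M → M'} {f : Fin k → M' → ℂ} {x : M}
    (hf : ∀ i, MDifferentiableAt I' 𝓘(ℂ, ℂ) (f i) (φ x)) (hφ : MDifferentiableAt I I' φ x) :
    pullback I I' φ (dWedge I' f) x = dWedge I (fun i => f i ∘ φ) x := by
  unfold pullback dWedge
  rw [wedge_compContinuousLinearMap]
  congr 1
  funext i
  exact (mvfderiv_comp x (hf i) hφ).symm

theorem pullback_congr {φ : M → M'} {η η' : DForm I' M' k} {x : M} (h : η (φ x) = η' (φ x)) :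
    pullback I I' φ η x = pullback I I' φ η' x := by
  unfold pullback
  rw [h]

theorem dWedge_congr {f g : Fin k → M → ℂ} {x : M} (h : ∀ i, f i =ᶠ[𝓝 x] g i) :
    dWedge I f x = dWedge I g x := by
  unfold dWedge
  congr 1
  funext i
  unfold mvfderiv
  -- The value at `x` must be rewritten too, since it is the base point of the target tangent space.
  rw [(h i).mfderiv_eq, (h i).eq_of_nhds]

/-- Pulling the product form back along `α` is continuous multilinear in `α`, and alternatization is
continuous linear. -/
theorem contDiff_wedge {n : ℕ∞ω} :
    ContDiff ℂ n (wedge : (Fin k → E →L[ℂ] ℂ) → E [⋀^Fin k]→L[ℂ] ℂ) := by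
  have h : (wedge : (Fin k → E →L[ℂ] ℂ) → E [⋀^Fin k]→L[ℂ] ℂ) = fun α =>
      alternatizationCLM (ContinuousMultilinearMap.compContinuousLinearMapContinuousMultilinear ℂ
        (fun _ : Fin k => E) (fun _ => ℂ) ℂ α
        (ContinuousMultilinearMap.mkPiAlgebra ℂ (Fin k) ℂ)) := rfl
  rw [h]
  exact (ContinuousLinearMap.contDiff _).comp
    ((ContinuousMultilinearMap.contDiff _).clm_apply contDiff_const)

/-- The wedge product of differentials of holomorphic functions is holomorphic. -/
theorem contMDiffAt_dWedge [IsManifold I ω M] [IsManifold I 1 M] {f : Fin k → M → ℂ} {x₀ : M}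
    (hf : ∀ i, ContMDiffAt I 𝓘(ℂ, ℂ) ω (f i) x₀) :
    ContMDiffAt I (I.prod 𝓘(ℂ, FormModel E k)) ω
      (fun x => (TotalSpace.mk' (FormModel E k) x (dWedge I f x) :
        TotalSpace (FormModel E k) (fun x : M => FormFiber I k x))) x₀ := by
  rw [contMDiffAt_section]
  have h1 : ∀ i, ContMDiffAt I 𝓘(ℂ, E →L[ℂ] ℂ) ω
      (fun x => (mvfderiv I (f i) x).comp
        ((trivializationAt E (TangentSpace I) x₀).symmL ℂ x)) x₀ := by
    intro i
    -- Analyticity survives differentiation, so no regularity is lost.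
    have h2 := (hf i).mfderiv_const (m := ω) (by simp)
    refine h2.congr_of_eventuallyEq (Filter.Eventually.of_forall fun x => ?_)
    simp only [inTangentCoordinates, ContinuousLinearMap.inCoordinates]
    ext v
    simp
    rfl
  have h3 := contDiff_wedge.contMDiff.contMDiffAt.comp x₀ (contMDiffAt_pi_space.2 h1)
  refine h3.congr_of_eventuallyEq (Filter.Eventually.of_forall fun x => ?_)
  change ContinuousAlternatingMap.inCoordinates E ℂ x₀ x x₀ x (dWedge I f x) = _
  ext v
  simp only [ContinuousAlternatingMap.inCoordinates, Function.comp_def, dWedge, wedge_apply]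
  simp [wedge_apply, Function.comp_def]

end Forms

/-! ### Open submanifolds -/

section Opens

variable {E H : Type*} [NormedAddCommGroup E] [NormedSpace ℂ E] [TopologicalSpace H]
  {I : ModelWithCorners ℂ E H} {M : Type*} [TopologicalSpace M] [ChartedSpace H M]
  {E' H' : Type*} [NormedAddCommGroup E'] [NormedSpace ℂ E'] [TopologicalSpace H']
  {I' : ModelWithCorners ℂ E' H'} {M' : Type*} [TopologicalSpace M'] [ChartedSpace H' M']

/-- The two maps have the same expression in charts, so only continuity has to be transferred, and
the inclusion is inducing. -/
theorem contMDiffAt_opens_iff {n : ℕ∞ω} {U : TopologicalSpace.Opens M'} {f : M → U} {x : M} :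
    ContMDiffAt I I' n f x ↔ ContMDiffAt I I' n (fun y => (f y : M')) x := by
  refine ⟨fun h => contMDiff_subtype_val.contMDiffAt.comp x h, fun h => ?_⟩
  rw [contMDiffAt_iff] at h ⊢
  exact ⟨Topology.IsInducing.subtypeVal.continuousAt_iff.2 h.1, h.2⟩

theorem mfderiv_subtype_val_surjective [IsManifold I 1 M] {U : TopologicalSpace.Opens M} (x : U) :
    Function.Surjective (mfderiv I I (Subtype.val : U → M) x) := by
  classical
  -- A local inverse of the inclusion; its value off `U` is irrelevant. The chain rule makes its
  -- differential a right inverse.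
  let r : M → U := fun y => if h : y ∈ U then ⟨y, h⟩ else x
  have hr : (fun y => (r y : M)) =ᶠ[𝓝 (x : M)] id := by
    filter_upwards [U.isOpen.mem_nhds x.2] with y hy
    simp [r, show y ∈ U from hy]
  have hrx : r x = x := by simp [r]
  have hrs : MDifferentiableAt I I r (x : M) :=
    (contMDiffAt_opens_iff.2 (contMDiffAt_id.congr_of_eventuallyEq hr)).mdifferentiableAt one_ne_zero
  have hv : MDifferentiableAt I I (Subtype.val : U → M) x :=
    (contMDiff_subtype_val (n := 1)).mdifferentiableAt one_ne_zero
  have hc := mfderiv_comp_of_eq (x := (x : M)) hv hrs hrx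
  have he : mfderiv I I ((Subtype.val : U → M) ∘ r) (x : M) = ContinuousLinearMap.id ℂ _ :=
    hr.mfderiv_eq.trans mfderiv_id
  intro v
  refine ⟨mfderiv I I r (x : M) v, ?_⟩
  rw [hrx] at hc
  exact (DFunLike.congr_fun hc v).symm.trans (DFunLike.congr_fun he v)

end Opens

/-! ### The coordinates `(z_w, w)` on the canonical bundle -/

section FibreCoord

variable {d : ℕ} {X : Type*} [TopologicalSpace X] [ChartedSpace (Fin d → ℂ) X]
  {w : OpenPartialHomeomorph X (Fin d → ℂ)}

theorem mdifferentiable_of_mem_maximalAtlas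
    (hw : w ∈ IsManifold.maximalAtlas 𝓘(ℂ, Fin d → ℂ) ω X) :
    w.MDifferentiable 𝓘(ℂ, Fin d → ℂ) 𝓘(ℂ, Fin d → ℂ) :=
  ⟨(contMDiffOn_of_mem_maximalAtlas hw).mdifferentiableOn (by simp),
    (contMDiffOn_symm_of_mem_maximalAtlas hw).mdifferentiableOn (by simp)⟩

theorem isInvertible_mfderiv_of_mem_maximalAtlas
    (hw : w ∈ IsManifold.maximalAtlas 𝓘(ℂ, Fin d → ℂ) ω X) {x : X} (hx : x ∈ w.source) :
    (mfderiv 𝓘(ℂ, Fin d → ℂ) 𝓘(ℂ, Fin d → ℂ) w x).IsInvertible :=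
  ⟨(mdifferentiable_of_mem_maximalAtlas hw).mfderiv hx, rfl⟩

variable [IsManifold 𝓘(ℂ, Fin d → ℂ) ω X]

/-- Reduces the trivialization of `K_X` to that of the tangent bundle; the trivial coefficient
bundle contributes nothing. -/
theorem trivializationAt_formFiber_snd (x₀ : X) (η : CanonicalBundle d X)
    (v : Fin d → Fin d → ℂ) :
    (trivializationAt (FormModel (Fin d → ℂ) d)
      (fun x : X => FormFiber 𝓘(ℂ, Fin d → ℂ) d x) x₀ η).2 v =
      η.2 fun i => (trivializationAt (Fin d → ℂ)
        (TangentSpace 𝓘(ℂ, Fin d → ℂ) : X → Type _) x₀).symmL ℂ η.1 (v i) := by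
  change ContinuousAlternatingMap.inCoordinates (Fin d → ℂ) ℂ x₀ η.1 x₀ η.1 η.2 v = _
  simp only [ContinuousAlternatingMap.inCoordinates]
  simp [Function.comp_def]

/-- The trivialization is an equivalence over the chart domain, so it can be cancelled even if `A`
is not invertible: both sides are then zero. Hence nearby points of a family need no invertibility
hypothesis. -/
theorem inverse_comp_symmL {V : Type*} [NormedAddCommGroup V] [NormedSpace ℂ V] {x₀ x : X}
    (hx : x ∈ (chartAt (Fin d → ℂ) x₀).source)
    (A : TangentSpace 𝓘(ℂ, Fin d → ℂ) x →L[ℂ] V) (v : V) :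
    (trivializationAt (Fin d → ℂ) (TangentSpace 𝓘(ℂ, Fin d → ℂ) : X → Type _) x₀).symmL ℂ x
      ((A ∘L (trivializationAt (Fin d → ℂ)
        (TangentSpace 𝓘(ℂ, Fin d → ℂ) : X → Type _) x₀).symmL ℂ x).inverse v) = A.inverse v := by
  have hb : x ∈ (trivializationAt (Fin d → ℂ)
      (TangentSpace 𝓘(ℂ, Fin d → ℂ) : X → Type _) x₀).baseSet := hx
  let T := (trivializationAt (Fin d → ℂ)
      (TangentSpace 𝓘(ℂ, Fin d → ℂ) : X → Type _) x₀).continuousLinearEquivAt ℂ x hb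
  have hT : (trivializationAt (Fin d → ℂ)
      (TangentSpace 𝓘(ℂ, Fin d → ℂ) : X → Type _) x₀).symmL ℂ x = (T.symm : _ →L[ℂ] _) :=
    ContinuousLinearMap.ext fun u =>
      (congrFun (Trivialization.symm_continuousLinearEquivAt_eq _ hb) u).symm
  rw [hT, ContinuousLinearMap.inverse_comp_equiv]
  simp

theorem inverse_continuousLinearMapAt {x₀ x : X}
    (hx : x ∈ (chartAt (Fin d → ℂ) x₀).source) (v : Fin d → ℂ) :
    ((trivializationAt (Fin d → ℂ)
        (TangentSpace 𝓘(ℂ, Fin d → ℂ) : X → Type _) x₀).continuousLinearMapAt ℂ x).inverse v =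
      (trivializationAt (Fin d → ℂ)
        (TangentSpace 𝓘(ℂ, Fin d → ℂ) : X → Type _) x₀).symmL ℂ x v := by
  have hb : x ∈ (trivializationAt (Fin d → ℂ)
      (TangentSpace 𝓘(ℂ, Fin d → ℂ) : X → Type _) x₀).baseSet := hx
  let T := (trivializationAt (Fin d → ℂ)
      (TangentSpace 𝓘(ℂ, Fin d → ℂ) : X → Type _) x₀).continuousLinearEquivAt ℂ x hb
  have hT : (trivializationAt (Fin d → ℂ)
      (TangentSpace 𝓘(ℂ, Fin d → ℂ) : X → Type _) x₀).continuousLinearMapAt ℂ x =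
        (T : _ →L[ℂ] _) :=
    ContinuousLinearMap.ext fun u =>
      (congrFun (Trivialization.coe_continuousLinearEquivAt_eq _ hb) u).symm
  rw [hT, ContinuousLinearMap.inverse_equiv]
  exact congrFun (Trivialization.symm_continuousLinearEquivAt_eq _ hb) v

/-- The fibre coordinate of the preferred chart is the coordinate of the trivialization. -/
theorem fibreCoord_chartAt {x₀ : X} {η : CanonicalBundle d X}
    (h : η.1 ∈ (chartAt (Fin d → ℂ) x₀).source) :
    fibreCoord (chartAt (Fin d → ℂ) x₀) η = (trivializationAt (FormModel (Fin d → ℂ) d)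
      (fun x : X => FormFiber 𝓘(ℂ, Fin d → ℂ) d x) x₀ η).2 fun i => Pi.single i (1 : ℂ) := by
  rw [trivializationAt_formFiber_snd]
  unfold fibreCoord coordVec
  congr 1
  funext i
  have h1 : (trivializationAt (Fin d → ℂ)
      (TangentSpace 𝓘(ℂ, Fin d → ℂ) : X → Type _) x₀).continuousLinearMapAt ℂ η.1 =
      mfderiv 𝓘(ℂ, Fin d → ℂ) 𝓘(ℂ, Fin d → ℂ) (chartAt (Fin d → ℂ) x₀) η.1 :=
    (TangentBundle.continuousLinearMapAt_trivializationAt (𝕜 := ℂ) (I := 𝓘(ℂ, Fin d → ℂ)) h).trans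
      (by congr 1)
  exact (congrArg (fun A : TangentSpace 𝓘(ℂ, Fin d → ℂ) η.1 →L[ℂ] (Fin d → ℂ) =>
    A.inverse (Pi.single i (1 : ℂ))) h1).symm.trans (inverse_continuousLinearMapAt h _)

section Smooth

variable {EN HN : Type*} [NormedAddCommGroup EN] [NormedSpace ℂ EN] [TopologicalSpace HN]
  {J : ModelWithCorners ℂ EN HN} {N : Type*} [TopologicalSpace N] [ChartedSpace HN N]

/-- A family of top degree forms, evaluated on the frame which corresponds to the standard basis
under the differentials of a family of local coordinates, is holomorphic. -/
theorem contMDiffAt_apply_frame [IsManifold J 1 N] {κ : N → CanonicalBundle d X}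
    {f : N → X → Fin d → ℂ}
    {n₀ : N} (hκ : ContMDiffAt J (IK d) ω κ n₀)
    (hf : ContMDiffAt (J.prod 𝓘(ℂ, Fin d → ℂ)) 𝓘(ℂ, Fin d → ℂ) ω (Function.uncurry f)
      (n₀, (κ n₀).1))
    (hinv : (mfderiv 𝓘(ℂ, Fin d → ℂ) 𝓘(ℂ, Fin d → ℂ) (f n₀) (κ n₀).1).IsInvertible) :
    ContMDiffAt J 𝓘(ℂ, ℂ) ω (fun n => (κ n).2 fun i =>
      (mfderiv 𝓘(ℂ, Fin d → ℂ) 𝓘(ℂ, Fin d → ℂ) (f n) (κ n).1).inverse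
        (Pi.single i (1 : ℂ) : Fin d → ℂ)) n₀ := by
  obtain ⟨hκ₁, hκ₂⟩ := contMDiffAt_totalSpace.1 hκ
  let T := trivializationAt (Fin d → ℂ)
    (TangentSpace 𝓘(ℂ, Fin d → ℂ) : X → Type _) (κ n₀).1
  -- The differentials in one fixed trivialization: now maps between fixed spaces, which can be
  -- inverted holomorphically in `n`.
  let A : N → (Fin d → ℂ) →L[ℂ] (Fin d → ℂ) := fun n =>
    (mfderiv 𝓘(ℂ, Fin d → ℂ) 𝓘(ℂ, Fin d → ℂ) (f n) (κ n).1) ∘L T.symmL ℂ (κ n).1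
  have hA : ContMDiffAt J 𝓘(ℂ, (Fin d → ℂ) →L[ℂ] (Fin d → ℂ)) ω A n₀ := by
    refine (ContMDiffAt.mfderiv f (fun n => (κ n).1) hf hκ₁ (m := ω) (by simp)).congr_of_eventuallyEq
      (Filter.Eventually.of_forall fun n => ?_)
    simp only [inTangentCoordinates, ContinuousLinearMap.inCoordinates, A]
    ext v
    simp
    rfl
  have hb : (κ n₀).1 ∈ T.baseSet := FiberBundle.mem_baseSet_trivializationAt' _
  have hA₀ : (A n₀).IsInvertible := by
    obtain ⟨B, hB⟩ := hinv
    refine ⟨(T.continuousLinearEquivAt ℂ _ hb).symm.trans B, ContinuousLinearMap.ext fun v => ?_⟩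
    exact (DFunLike.congr_fun hB _).trans (congrArg _
      (congrFun (Trivialization.symm_continuousLinearEquivAt_eq T hb) v))
  have hAi : ContMDiffAt J 𝓘(ℂ, (Fin d → ℂ) →L[ℂ] (Fin d → ℂ)) ω (fun n => (A n).inverse) n₀ :=
    hA₀.contDiffAt_map_inverse.contMDiffAt.comp n₀ hA
  have hfin : ContMDiffAt J 𝓘(ℂ, ℂ) ω (fun n =>
      ((trivializationAt (FormModel (Fin d → ℂ) d)
        (fun x : X => FormFiber 𝓘(ℂ, Fin d → ℂ) d x) (κ n₀).1 (κ n)).2.compContinuousLinearMap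
          (A n).inverse) fun i => Pi.single i (1 : ℂ)) n₀ := by
    have h1 := ((contDiff_compContinuousLinearMapCLM (𝕜 := ℂ) (ι := Fin d) (E := Fin d → ℂ)
      (F := Fin d → ℂ) (G := ℂ)).contMDiff.contMDiffAt.comp n₀ hAi).clm_apply hκ₂
    exact ((evalStd d).toLinearMap.toContinuousLinearMap.contDiff.contMDiff.contMDiffAt).comp n₀ h1
  refine hfin.congr_of_eventuallyEq ?_
  filter_upwards [hκ₁.continuousAt.preimage_mem_nhds (T.open_baseSet.mem_nhds hb)] with n hn
  rw [ContinuousAlternatingMap.compContinuousLinearMap_apply, trivializationAt_formFiber_snd]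
  congr 1
  funext i
  exact (inverse_comp_symmL hn (V := Fin d → ℂ)
    (mfderiv 𝓘(ℂ, Fin d → ℂ) 𝓘(ℂ, Fin d → ℂ) (f n) (κ n).1) (Pi.single i 1)).symm

theorem contMDiffAt_fibreCoord (hw : w ∈ IsManifold.maximalAtlas 𝓘(ℂ, Fin d → ℂ) ω X)
    {η : CanonicalBundle d X} (h : η.1 ∈ w.source) :
    ContMDiffAt (IK d) 𝓘(ℂ, ℂ) ω (fibreCoord w) η :=
  contMDiffAt_apply_frame (f := fun _ => w) contMDiffAt_id
    ((contMDiffAt_of_mem_maximalAtlas hw h).comp (η, η.1) contMDiffAt_snd)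
    (isInvertible_mfderiv_of_mem_maximalAtlas hw h)

/-- Smoothness of a map into `K_X` in terms of the fibre coordinate. -/
theorem contMDiffAt_canonicalBundle {κ : N → CanonicalBundle d X} {n₀ : N}
    (h₁ : ContMDiffAt J 𝓘(ℂ, Fin d → ℂ) ω (fun n => (κ n).1) n₀)
    (h₂ : ContMDiffAt J 𝓘(ℂ, ℂ) ω
      (fun n => fibreCoord (chartAt (Fin d → ℂ) (κ n₀).1) (κ n)) n₀) :
    ContMDiffAt J (IK d) ω κ n₀ := by
  refine contMDiffAt_totalSpace.2 ⟨h₁, ?_⟩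
  -- The model fibre is the line spanned by `stdVol d`, so the scalar coordinate determines the
  -- vector one.
  have h3 : ContMDiffAt J 𝓘(ℂ, FormModel (Fin d → ℂ) d) ω (fun n =>
      fibreCoord (chartAt (Fin d → ℂ) (κ n₀).1) (κ n) • stdVol d) n₀ :=
    h₂.smul contMDiffAt_const
  refine h3.congr_of_eventuallyEq ?_
  filter_upwards [h₁.continuousAt.preimage_mem_nhds
    ((chartAt (Fin d → ℂ) (κ n₀).1).open_source.mem_nhds (mem_chart_source _ _))] with n hn
  rw [fibreCoord_chartAt hn, eval_smul_stdVol]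

end Smooth

/-- The point of `K_X` over `x` with fibre coordinate `z` in the preferred chart at `x₀`. -/
def ofCoord (x₀ : X) (p : X × ℂ) : CanonicalBundle d X :=
  (trivializationAt (FormModel (Fin d → ℂ) d)
      (fun x : X => FormFiber 𝓘(ℂ, Fin d → ℂ) d x) x₀).toOpenPartialHomeomorph.symm
    (p.1, p.2 • stdVol d)

variable {x₀ : X}

theorem mem_target_trivializationAt {p : X × FormModel (Fin d → ℂ) d}
    (h : p.1 ∈ (chartAt (Fin d → ℂ) x₀).source) :
    p ∈ (trivializationAt (FormModel (Fin d → ℂ) d)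
      (fun x : X => FormFiber 𝓘(ℂ, Fin d → ℂ) d x) x₀).target :=
  (Trivialization.mem_target _).2 ⟨h, mem_univ _⟩

theorem ofCoord_fst {p : X × ℂ} (h : p.1 ∈ (chartAt (Fin d → ℂ) x₀).source) :
    (ofCoord (d := d) x₀ p).1 = p.1 :=
  Trivialization.proj_symm_apply _ (mem_target_trivializationAt h)

theorem fibreCoord_ofCoord {p : X × ℂ} (h : p.1 ∈ (chartAt (Fin d → ℂ) x₀).source) :
    fibreCoord (chartAt (Fin d → ℂ) x₀) (ofCoord x₀ p) = p.2 := by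
  rw [fibreCoord_chartAt (by rw [ofCoord_fst h]; exact h), ofCoord]
  erw [Trivialization.apply_symm_apply _ (mem_target_trivializationAt h)]
  exact (evalStd d).right_inv p.2

theorem ofCoord_fibreCoord {η : CanonicalBundle d X}
    (h : η.1 ∈ (chartAt (Fin d → ℂ) x₀).source) :
    ofCoord x₀ (η.1, fibreCoord (chartAt (Fin d → ℂ) x₀) η) = η := by
  have hs : η ∈ (trivializationAt (FormModel (Fin d → ℂ) d)
      (fun x : X => FormFiber 𝓘(ℂ, Fin d → ℂ) d x) x₀).source :=
    (Trivialization.mem_source _).2 ⟨h, mem_univ _⟩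
  unfold ofCoord
  rw [fibreCoord_chartAt h, eval_smul_stdVol]
  exact Trivialization.symm_apply_mk_proj _ hs

theorem contMDiffAt_ofCoord {p : X × ℂ} (h : p.1 ∈ (chartAt (Fin d → ℂ) x₀).source) :
    ContMDiffAt (𝓘(ℂ, Fin d → ℂ).prod 𝓘(ℂ, ℂ)) (IK d) ω (ofCoord (d := d) x₀) p := by
  have h1 := (Trivialization.contMDiffOn_symm (IB := 𝓘(ℂ, Fin d → ℂ)) (n := ω)
    (trivializationAt (FormModel (Fin d → ℂ) d)
      (fun x : X => FormFiber 𝓘(ℂ, Fin d → ℂ) d x) x₀)).contMDiffAt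
    ((OpenPartialHomeomorph.open_target _).mem_nhds
      (mem_target_trivializationAt (p := (p.1, p.2 • stdVol d)) h))
  exact h1.comp p (contMDiffAt_fst.prodMk (contMDiffAt_snd.smul contMDiffAt_const))

end FibreCoord

/-! ### Chart independence, holomorphy and nonvanishing of the canonical form -/

theorem wedge_cons_smul {V : Type*} [AddCommGroup V] [Module ℂ V] [TopologicalSpace V]
    [ContinuousConstSMul ℂ V] {k : ℕ} (c : ℂ) (β : V →L[ℂ] ℂ) (α : Fin k → V →L[ℂ] ℂ) :
    wedge (Fin.cons (c • β) α : Fin (k + 1) → V →L[ℂ] ℂ) =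
      c • wedge (Fin.cons β α : Fin (k + 1) → V →L[ℂ] ℂ) := by
  ext v
  rw [ContinuousAlternatingMap.smul_apply, wedge_apply, wedge_apply, Matrix.det_succ_row_zero,
    Matrix.det_succ_row_zero, smul_eq_mul, Finset.mul_sum]
  refine Finset.sum_congr rfl fun j _ => ?_
  have h : ∀ γ : V →L[ℂ] ℂ, (Matrix.of fun i j => (Fin.cons γ α : Fin (k + 1) → V →L[ℂ] ℂ) i (v j)
      ).submatrix Fin.succ j.succAbove = Matrix.of fun i l => α i (v (j.succAbove l)) :=
    fun _ => rfl
  rw [h, h]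
  simp only [Matrix.of_apply, Fin.cons_zero, smul_apply, smul_eq_mul]
  ring

/-- The wedge product is unchanged under a block triangular change of covectors of determinant
one. -/
theorem wedge_cons_eq {V : Type*} [AddCommGroup V] [Module ℂ V] [TopologicalSpace V]
    [IsTopologicalAddGroup V] [ContinuousSMul ℂ V] {k : ℕ} (J : ℂ) (c : Fin k → ℂ)
    (A : Matrix (Fin k) (Fin k) ℂ) (hJ : J * A.det = 1)
    {β β' : V →L[ℂ] ℂ} {α α' : Fin k → V →L[ℂ] ℂ} (hβ : β' = J • β + ∑ j, c j • α j)
    (hα : ∀ i, α' i = ∑ j, A i j • α j) :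
    wedge (Fin.cons β' α' : Fin (k + 1) → V →L[ℂ] ℂ) =
      wedge (Fin.cons β α : Fin (k + 1) → V →L[ℂ] ℂ) := by
  -- First row `(J, c)`, zeros below `J`, and the block `A`; expansion along the first column gives
  -- `J * A.det`.
  let N : Matrix (Fin (k + 1)) (Fin (k + 1)) ℂ :=
    Matrix.of (Fin.cons (Fin.cons J c) fun i => Fin.cons 0 (A i))
  have hN : N.det = 1 := by
    rw [Matrix.det_succ_column_zero, Fin.sum_univ_succ]
    have h0 : N.submatrix (Fin.succAbove 0) Fin.succ = A := rfl
    rw [h0]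
    simp [N, hJ]
  have h := wedge_sum_smul N (Fin.cons β α : Fin (k + 1) → V →L[ℂ] ℂ)
  rw [hN, one_smul] at h
  rw [← h]
  congr 1
  funext i
  rw [Fin.sum_univ_succ]
  refine Fin.cases ?_ (fun i => ?_) i
  · simp [N, hβ]
  · refine (hα i).trans ?_
    have h0 : ∑ j, A i j • α j = (0 : ℂ) • β + ∑ j, A i j • α j := by
      ext v
      rw [add_apply, smul_apply, zero_smul, zero_add]
    exact h0

section CanonicalForm

variable {d : ℕ} {X : Type*} [TopologicalSpace X] [ChartedSpace (Fin d → ℂ) X]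
  {w : OpenPartialHomeomorph X (Fin d → ℂ)}

theorem mvfderiv_apply_coord {b : X}
    (hw : MDifferentiableAt 𝓘(ℂ, Fin d → ℂ) 𝓘(ℂ, Fin d → ℂ) w b) (i : Fin d)
    (v : TangentSpace 𝓘(ℂ, Fin d → ℂ) b) :
    mvfderiv 𝓘(ℂ, Fin d → ℂ) (fun x => w x i) b v =
      (mfderiv 𝓘(ℂ, Fin d → ℂ) 𝓘(ℂ, Fin d → ℂ) w b v : Fin d → ℂ) i := by
  let p : (Fin d → ℂ) →L[ℂ] ℂ := ContinuousLinearMap.proj (R := ℂ) (φ := fun _ : Fin d => ℂ) i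
  have hp : MDifferentiableAt 𝓘(ℂ, Fin d → ℂ) 𝓘(ℂ, ℂ) p (w b) :=
    p.differentiableAt.mdifferentiableAt
  have h1 := mvfderiv_comp_apply b hp hw v
  refine h1.trans ?_
  unfold mvfderiv
  rw [mfderiv_eq_fderiv, p.fderiv]
  rfl

theorem mdifferentiableAt_apply_coord {b : X}
    (hw : MDifferentiableAt 𝓘(ℂ, Fin d → ℂ) 𝓘(ℂ, Fin d → ℂ) w b) (i : Fin d) :
    MDifferentiableAt 𝓘(ℂ, Fin d → ℂ) 𝓘(ℂ, ℂ) (fun x => w x i) b := by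
  have hp : MDifferentiableAt 𝓘(ℂ, Fin d → ℂ) 𝓘(ℂ, ℂ)
      (ContinuousLinearMap.proj (R := ℂ) (φ := fun _ : Fin d => ℂ) i) (w b) :=
    (ContinuousLinearMap.differentiableAt _).mdifferentiableAt
  exact hp.comp b hw

/-- The `dw_j` are the dual basis of the coordinate vectors, both being transported from `ℂ^d` by
the isomorphism `dw`. -/
theorem covector_eq_sum (hw : w ∈ IsManifold.maximalAtlas 𝓘(ℂ, Fin d → ℂ) ω X) {b : X}
    (hb : b ∈ w.source) (L : TangentSpace 𝓘(ℂ, Fin d → ℂ) b →L[ℂ] ℂ) :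
    L = ∑ j, L (coordVec w j b) • mvfderiv 𝓘(ℂ, Fin d → ℂ) (fun x => w x j) b := by
  have hd := (mdifferentiable_of_mem_maximalAtlas hw).mdifferentiableAt hb
  let D : TangentSpace 𝓘(ℂ, Fin d → ℂ) b ≃L[ℂ] (Fin d → ℂ) :=
    (mdifferentiable_of_mem_maximalAtlas hw).mfderiv hb
  have hD : ∀ j, coordVec w j b = D.symm (Pi.single j 1) := fun j =>
    DFunLike.congr_fun (ContinuousLinearMap.inverse_equiv D) _
  ext v
  have hv : v = ∑ j, D v j • D.symm (Pi.single j 1) := by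
    apply D.injective
    rw [map_sum]
    simp only [map_smul, ContinuousLinearEquiv.apply_symm_apply]
    exact (pi_eq_sum_univ' (D v))
  conv_lhs => rw [hv]
  rw [map_sum]
  simp only [map_smul, hD, smul_eq_mul, sum_apply, smul_apply]
  refine Finset.sum_congr rfl fun j _ => ?_
  rw [mvfderiv_apply_coord hd, mul_comm]
  rfl

/-- The transition between the coordinate frames of two charts. -/
def frameMap (w w' : OpenPartialHomeomorph X (Fin d → ℂ)) (b : X) :
    (Fin d → ℂ) →L[ℂ] (Fin d → ℂ) :=
  (show TangentSpace 𝓘(ℂ, Fin d → ℂ) b →L[ℂ] (Fin d → ℂ) from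
    mfderiv 𝓘(ℂ, Fin d → ℂ) 𝓘(ℂ, Fin d → ℂ) w b).comp
  (ContinuousLinearMap.inverse (show TangentSpace 𝓘(ℂ, Fin d → ℂ) b →L[ℂ] (Fin d → ℂ) from
    mfderiv 𝓘(ℂ, Fin d → ℂ) 𝓘(ℂ, Fin d → ℂ) w' b))

/-- The determinant of the transition between the coordinate frames of two charts. -/
def frameDet (w w' : OpenPartialHomeomorph X (Fin d → ℂ)) (b : X) : ℂ :=
  LinearMap.det (frameMap w w' b).toLinearMap

variable {w' : OpenPartialHomeomorph X (Fin d → ℂ)}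

/-- The two transition maps are inverse to each other. -/
theorem frameDet_mul_frameDet (hw : w ∈ IsManifold.maximalAtlas 𝓘(ℂ, Fin d → ℂ) ω X)
    (hw' : w' ∈ IsManifold.maximalAtlas 𝓘(ℂ, Fin d → ℂ) ω X) {b : X} (hb : b ∈ w.source)
    (hb' : b ∈ w'.source) : frameDet w w' b * frameDet w' w b = 1 := by
  let D : TangentSpace 𝓘(ℂ, Fin d → ℂ) b ≃L[ℂ] (Fin d → ℂ) :=
    (mdifferentiable_of_mem_maximalAtlas hw).mfderiv hb
  let D' : TangentSpace 𝓘(ℂ, Fin d → ℂ) b ≃L[ℂ] (Fin d → ℂ) :=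
    (mdifferentiable_of_mem_maximalAtlas hw').mfderiv hb'
  have h : frameDet w w' b = LinearMap.det (D'.symm.trans D).toLinearEquiv.toLinearMap := by
    unfold frameDet
    congr 1
    refine LinearMap.ext fun v => ?_
    exact congrArg _ (DFunLike.congr_fun (ContinuousLinearMap.inverse_equiv D') _)
  have h' : frameDet w' w b = LinearMap.det (D.symm.trans D').toLinearEquiv.toLinearMap := by
    unfold frameDet
    congr 1
    refine LinearMap.ext fun v => ?_
    exact congrArg _ (DFunLike.congr_fun (ContinuousLinearMap.inverse_equiv D) _)
  rw [h, h', ← LinearMap.det_comp]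
  convert LinearMap.det_id (M := Fin d → ℂ) (A := ℂ)
  refine LinearMap.ext fun v => ?_
  simp

/-- Transported to `ℂ^d` by `dw`, the form is a top form, and the frame of `w'` is the image of the
standard basis under `frameMap w w'`. -/
theorem fibreCoord_eq_mul (hw : w ∈ IsManifold.maximalAtlas 𝓘(ℂ, Fin d → ℂ) ω X)
    {η : CanonicalBundle d X} (h : η.1 ∈ w.source) :
    fibreCoord w' η = frameDet w w' η.1 * fibreCoord w η := by
  let D : TangentSpace 𝓘(ℂ, Fin d → ℂ) η.1 ≃L[ℂ] (Fin d → ℂ) :=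
    (mdifferentiable_of_mem_maximalAtlas hw).mfderiv h
  have hD : ∀ j, coordVec w j η.1 = D.symm (Pi.single j 1) := fun j =>
    DFunLike.congr_fun (ContinuousLinearMap.inverse_equiv D) _
  have hD' : ∀ j, coordVec w' j η.1 = D.symm (D (coordVec w' j η.1)) := fun j => by simp
  have h1 := formModel_apply_eq_det (d := d)
    (η.2.compContinuousLinearMap (D.symm : (Fin d → ℂ) →L[ℂ] TangentSpace 𝓘(ℂ, Fin d → ℂ) η.1))
    (frameMap w w' η.1)
  unfold fibreCoord
  simp only [hD]
  rw [funext hD']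
  exact h1

variable [IsManifold 𝓘(ℂ, Fin d → ℂ) ω X]

/-- The coordinates `(z_w, w)` of `K_X`. -/
def bundleCoord (w : OpenPartialHomeomorph X (Fin d → ℂ)) :
    Fin (d + 1) → CanonicalBundle d X → ℂ :=
  Fin.cons (fibreCoord w) fun i η => w η.1 i

theorem localForm_eq_dWedge (w : OpenPartialHomeomorph X (Fin d → ℂ)) :
    localForm w = dWedge (IK d) (bundleCoord w) := rfl

theorem localForm_apply (w : OpenPartialHomeomorph X (Fin d → ℂ)) (η : CanonicalBundle d X) :
    localForm w η = wedge (Fin.cons (mvfderiv (IK d) (fibreCoord w) η)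
      fun i => mvfderiv (IK d) (fun ζ : CanonicalBundle d X => w ζ.1 i) η) := by
  unfold localForm dWedge
  congr 1
  funext i
  refine Fin.cases ?_ (fun i => ?_) i <;> rfl

theorem contMDiffAt_bundleCoord (hw : w ∈ IsManifold.maximalAtlas 𝓘(ℂ, Fin d → ℂ) ω X)
    {η : CanonicalBundle d X} (h : η.1 ∈ w.source) (i : Fin (d + 1)) :
    ContMDiffAt (IK d) 𝓘(ℂ, ℂ) ω (bundleCoord w i) η := by
  refine Fin.cases (contMDiffAt_fibreCoord hw h) (fun i => ?_) i
  exact contMDiffAt_pi_space.1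
    ((contMDiffAt_of_mem_maximalAtlas hw h).comp η (contMDiffAt_proj _)) i

theorem mdifferentiableAt_bundleCoord (hw : w ∈ IsManifold.maximalAtlas 𝓘(ℂ, Fin d → ℂ) ω X)
    {η : CanonicalBundle d X} (h : η.1 ∈ w.source) (i : Fin (d + 1)) :
    MDifferentiableAt (IK d) 𝓘(ℂ, ℂ) (bundleCoord w i) η :=
  (contMDiffAt_bundleCoord hw h i).mdifferentiableAt (by simp)

/-- The form `dz_w ∧ dw₁ ∧ ⋯ ∧ dw_d` does not depend on the chart. -/
theorem canonicalForm_eq_localForm (hw : w ∈ IsManifold.maximalAtlas 𝓘(ℂ, Fin d → ℂ) ω X)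
    (η : CanonicalBundle d X) (h : η.1 ∈ w.source) : canonicalForm η = localForm w η := by
  symm
  let φ := chartAt (Fin d → ℂ) η.1
  have hφ : φ ∈ IsManifold.maximalAtlas 𝓘(ℂ, Fin d → ℂ) ω X := IsManifold.chart_mem_maximalAtlas _
  have hφη : η.1 ∈ φ.source := mem_chart_source _ _
  have hdw := (mdifferentiable_of_mem_maximalAtlas hw).mdifferentiableAt h
  have hdφ := (mdifferentiable_of_mem_maximalAtlas hφ).mdifferentiableAt hφη
  have hπ : MDifferentiableAt (IK d) 𝓘(ℂ, Fin d → ℂ)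
      (fun ζ : CanonicalBundle d X => ζ.1) η :=
    (contMDiffAt_proj (n := 1) _).mdifferentiableAt one_ne_zero
  let P := mfderiv (IK d) 𝓘(ℂ, Fin d → ℂ) (fun ζ : CanonicalBundle d X => ζ.1) η
  -- The determinant is `z_w` along the local section on which `z_φ = 1`, so it inherits holomorphy
  -- from `z_w`.
  have hJ : ContMDiffAt 𝓘(ℂ, Fin d → ℂ) 𝓘(ℂ, ℂ) ω (frameDet φ w) η.1 := by
    have hs : (ofCoord (d := d) η.1 (η.1, (1 : ℂ))).1 = η.1 := ofCoord_fst hφη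
    have h1 : ContMDiffAt 𝓘(ℂ, Fin d → ℂ) 𝓘(ℂ, ℂ) ω
        (fun b => fibreCoord w (ofCoord (d := d) η.1 (b, (1 : ℂ)))) η.1 :=
      (contMDiffAt_fibreCoord hw (by rw [hs]; exact h)).comp η.1
        ((contMDiffAt_ofCoord hφη).comp η.1 (contMDiffAt_id.prodMk contMDiffAt_const))
    refine h1.congr_of_eventuallyEq ?_
    filter_upwards [φ.open_source.mem_nhds hφη] with b hb
    rw [fibreCoord_eq_mul hφ (by rw [ofCoord_fst hb]; exact hb), fibreCoord_ofCoord hb,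
      ofCoord_fst hb, mul_one]
  have hJd : MDifferentiableAt 𝓘(ℂ, Fin d → ℂ) 𝓘(ℂ, ℂ) (frameDet φ w) η.1 :=
    hJ.mdifferentiableAt (by simp)
  let L := mvfderiv 𝓘(ℂ, Fin d → ℂ) (frameDet φ w) η.1
  -- Product rule for `z_w = (J ∘ π) z_φ`.
  have hz : mvfderiv (IK d) (fibreCoord w) η =
      frameDet φ w η.1 • mvfderiv (IK d) (fibreCoord φ) η + fibreCoord φ η • L.comp P := by
    have h1 : fibreCoord w =ᶠ[𝓝 η]
        (fun ζ => (frameDet φ w ∘ fun ζ : CanonicalBundle d X => ζ.1) ζ) * fibreCoord φ := by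
      filter_upwards [(contMDiffAt_proj (n := 1) (IB := 𝓘(ℂ, Fin d → ℂ)) _).continuousAt.preimage_mem_nhds
        (φ.open_source.mem_nhds hφη)] with ζ hζ
      exact fibreCoord_eq_mul hφ hζ
    have h2 : mvfderiv (IK d) (fibreCoord w) η = mvfderiv (IK d)
        ((fun ζ => (frameDet φ w ∘ fun ζ : CanonicalBundle d X => ζ.1) ζ) * fibreCoord φ) η := by
      unfold mvfderiv
      rw [h1.mfderiv_eq, h1.eq_of_nhds]
    rw [h2]
    refine (mvfderiv_mul (hJd.comp η hπ) (mdifferentiableAt_bundleCoord hφ hφη 0)).trans ?_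
    rw [mvfderiv_comp η hJd hπ]
    rfl
  have hc : ∀ (ψ : OpenPartialHomeomorph X (Fin d → ℂ)),
      MDifferentiableAt 𝓘(ℂ, Fin d → ℂ) 𝓘(ℂ, Fin d → ℂ) ψ η.1 → ∀ i,
      mvfderiv (IK d) (fun ζ : CanonicalBundle d X => ψ ζ.1 i) η =
        (mvfderiv 𝓘(ℂ, Fin d → ℂ) (fun x => ψ x i) η.1).comp P := fun ψ hψ i =>
    mvfderiv_comp η (mdifferentiableAt_apply_coord hψ i) hπ
  -- Every covector pulled back from the base is a combination of the `dφ_j`; this is applied to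
  -- `dJ` and to each `dw_i`.
  have hexp : ∀ M : TangentSpace 𝓘(ℂ, Fin d → ℂ) η.1 →L[ℂ] ℂ, M.comp P =
      ∑ j, M (coordVec φ j η.1) •
        mvfderiv (IK d) (fun ζ : CanonicalBundle d X => φ ζ.1 j) η := by
    intro M
    conv_lhs => rw [covector_eq_sum hφ hφη M]
    simp only [hc φ hdφ]
    ext v
    simp
  let A : Matrix (Fin d) (Fin d) ℂ := Matrix.of fun i j =>
    mvfderiv 𝓘(ℂ, Fin d → ℂ) (fun x => w x i) η.1 (coordVec φ j η.1)
  have hA : A.det = frameDet w φ η.1 := by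
    unfold frameDet
    rw [← LinearMap.det_toMatrix']
    congr 1
    ext i j
    simp only [A, Matrix.of_apply]
    rw [mvfderiv_apply_coord hdw, LinearMap.toMatrix'_apply]
    rfl
  change localForm w η = localForm φ η
  rw [localForm_apply, localForm_apply]
  refine wedge_cons_eq (frameDet φ w η.1) (fun j => fibreCoord φ η * L (coordVec φ j η.1)) A ?_ ?_ ?_
  · rw [hA]
    exact frameDet_mul_frameDet hφ hw hφη h
  · rw [hz, hexp L, Finset.smul_sum]
    simp only [smul_smul]
  · intro i
    rw [hc w hdw, hexp]
    rfl

/-- The chart in the definition varies with the point; chart independence freezes it near `η`. -/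
theorem canonicalForm_eventuallyEq (η : CanonicalBundle d X) :
    ∀ᶠ ζ in 𝓝 η, canonicalForm ζ = localForm (chartAt (Fin d → ℂ) η.1) ζ := by
  filter_upwards [(contMDiffAt_proj (n := 1) (IB := 𝓘(ℂ, Fin d → ℂ)) _).continuousAt.preimage_mem_nhds
    ((chartAt (Fin d → ℂ) η.1).open_source.mem_nhds (mem_chart_source _ _))] with ζ hζ
  exact canonicalForm_eq_localForm (IsManifold.chart_mem_maximalAtlas _) ζ hζ

theorem isHolomorphicForm_canonicalForm :
    IsHolomorphicForm (IK d) (canonicalForm (d := d) (X := X)) := by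
  intro η
  refine (contMDiffAt_dWedge (f := bundleCoord (chartAt (Fin d → ℂ) η.1)) fun i =>
    contMDiffAt_bundleCoord (IsManifold.chart_mem_maximalAtlas _)
      (mem_chart_source _ _) i).congr_of_eventuallyEq ?_
  filter_upwards [canonicalForm_eventuallyEq η] with ζ hζ
  rw [hζ]
  rfl

theorem canonicalForm_ne_zero (η : CanonicalBundle d X) : canonicalForm η ≠ 0 := by
  let φ := chartAt (Fin d → ℂ) η.1
  have hφ : φ ∈ IsManifold.maximalAtlas 𝓘(ℂ, Fin d → ℂ) ω X := IsManifold.chart_mem_maximalAtlas _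
  have hφη : η.1 ∈ φ.source := mem_chart_source _ _
  -- The parametrization inverse to `(z_φ, φ)`. Its differential takes the standard basis to vectors
  -- dual to `dz_φ, dφ₁, …, dφ_d`.
  let S : ℂ × (Fin d → ℂ) → CanonicalBundle d X := fun p => ofCoord η.1 (φ.symm p.2, p.1)
  let p₀ : ℂ × (Fin d → ℂ) := (fibreCoord φ η, φ η.1)
  have ht : φ η.1 ∈ φ.target := φ.map_source hφη
  have hsrc : φ.symm (φ η.1) ∈ φ.source := φ.map_target ht
  have hS₀ : S p₀ = η := by
    simp only [S, p₀, φ.left_inv hφη]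
    exact ofCoord_fibreCoord hφη
  have hS : ContMDiffAt 𝓘(ℂ, ℂ × (Fin d → ℂ)) (IK d) ω S p₀ := by
    have h1 : ContMDiffAt 𝓘(ℂ, ℂ × (Fin d → ℂ)) 𝓘(ℂ, Fin d → ℂ) ω
        (fun p : ℂ × (Fin d → ℂ) => φ.symm p.2) p₀ :=
      (contMDiffAt_symm_of_mem_maximalAtlas hφ ht).comp p₀ contDiff_snd.contMDiff.contMDiffAt
    exact (contMDiffAt_ofCoord hsrc).comp p₀ (h1.prodMk contDiff_fst.contMDiff.contMDiffAt)
  have hSd : MDifferentiableAt 𝓘(ℂ, ℂ × (Fin d → ℂ)) (IK d) S p₀ :=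
    hS.mdifferentiableAt (by simp)
  let ℓ : Fin (d + 1) → (ℂ × (Fin d → ℂ)) →L[ℂ] ℂ := Fin.cons (ContinuousLinearMap.fst ℂ _ _)
    fun i => (ContinuousLinearMap.proj (R := ℂ) (φ := fun _ : Fin d => ℂ) i).comp
      (ContinuousLinearMap.snd ℂ _ _)
  have hev : ∀ i, bundleCoord φ i ∘ S =ᶠ[𝓝 p₀] ℓ i := by
    intro i
    filter_upwards [continuousAt_snd.preimage_mem_nhds (φ.open_target.mem_nhds ht)] with p hp
    have hp' : φ.symm p.2 ∈ φ.source := φ.map_target hp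
    refine Fin.cases ?_ (fun i => ?_) i
    · exact fibreCoord_ofCoord (p := (φ.symm p.2, p.1)) hp'
    · change φ (ofCoord (d := d) η.1 (φ.symm p.2, p.1)).1 i = p.2 i
      rw [ofCoord_fst (p := (φ.symm p.2, p.1)) hp', φ.right_inv hp]
  have hd : ∀ i u, mvfderiv (IK d) (bundleCoord φ i) η
      (mfderiv 𝓘(ℂ, ℂ × (Fin d → ℂ)) (IK d) S p₀ u) = ℓ i u := by
    intro i u
    have h1 := mvfderiv_comp_apply_of_eq p₀
      (mdifferentiableAt_bundleCoord hφ hφη i) hSd hS₀ u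
    refine h1.symm.trans ?_
    unfold mvfderiv
    rw [(hev i).mfderiv_eq, mfderiv_eq_fderiv, (ℓ i).fderiv]
    rfl
  let v : Fin (d + 1) → ℂ × (Fin d → ℂ) := Fin.cons (1, 0) fun j => (0, Pi.single j 1)
  refine wedge_ne_zero (fun j => mfderiv 𝓘(ℂ, ℂ × (Fin d → ℂ)) (IK d) S p₀ (v j))
    fun i j => (hd i (v j)).trans ?_
  refine Fin.cases ?_ (fun i => ?_) i <;> refine Fin.cases ?_ (fun j => ?_) j
  · simp [ℓ, v]
  · simp [ℓ, v, (Fin.succ_ne_zero _).symm]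
  · simp [ℓ, v]
  · simp [ℓ, v, Matrix.one_apply, Pi.single_apply]

end CanonicalForm

/-! ### The actions of `Aut X` and `ℂˣ` on the canonical bundle -/

section Actions

variable {d : ℕ} {X : Type*} [TopologicalSpace X] [ChartedSpace (Fin d → ℂ) X]
  {w : OpenPartialHomeomorph X (Fin d → ℂ)}

theorem isInvertible_mfderiv_aut (g : AutX d X) (x : X) :
    (mfderiv 𝓘(ℂ, Fin d → ℂ) 𝓘(ℂ, Fin d → ℂ) g x).IsInvertible :=
  ⟨g.mfderivToContinuousLinearEquiv (by simp) x, rfl⟩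

theorem mdifferentiableAt_aut (g : AutX d X) (x : X) :
    MDifferentiableAt 𝓘(ℂ, Fin d → ℂ) 𝓘(ℂ, Fin d → ℂ) g x :=
  g.contMDiff.mdifferentiableAt (by simp)

theorem inverse_mfderiv_comp_aut {V : Type*} [NormedAddCommGroup V] [NormedSpace ℂ V] (g : AutX d X)
    {f : X → V} {x : X}
    (hf : MDifferentiableAt 𝓘(ℂ, Fin d → ℂ) 𝓘(ℂ, V) f (g x)) (v : V) :
    (mfderiv 𝓘(ℂ, Fin d → ℂ) 𝓘(ℂ, V) (f ∘ g) x).inverse v =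
      (mfderiv 𝓘(ℂ, Fin d → ℂ) 𝓘(ℂ, Fin d → ℂ) g x).inverse
        ((mfderiv 𝓘(ℂ, Fin d → ℂ) 𝓘(ℂ, V) f (g x)).inverse v) := by
  rw [mfderiv_comp x hf (mdifferentiableAt_aut g x)]
  exact (isInvertible_mfderiv_aut g x).inverse_comp_apply_of_right

/-- The chart `w ∘ g`. -/
def pullChart (g : AutX d X) (w : OpenPartialHomeomorph X (Fin d → ℂ)) :
    OpenPartialHomeomorph X (Fin d → ℂ) :=
  g.toHomeomorph.transOpenPartialHomeomorph w

theorem autK_one (η : CanonicalBundle d X) : autK (1 : AutX d X) η = η := by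
  have h : (mfderiv 𝓘(ℂ, Fin d → ℂ) 𝓘(ℂ, Fin d → ℂ) (1 : AutX d X) η.1).inverse =
      ContinuousLinearMap.id ℂ (TangentSpace 𝓘(ℂ, Fin d → ℂ) η.1) := by
    have h1 : mfderiv 𝓘(ℂ, Fin d → ℂ) 𝓘(ℂ, Fin d → ℂ) (1 : AutX d X) η.1 =
        ContinuousLinearMap.id ℂ (TangentSpace 𝓘(ℂ, Fin d → ℂ) η.1) := mfderiv_id
    exact (congrArg ContinuousLinearMap.inverse h1).trans ContinuousLinearMap.inverse_id
  obtain ⟨x, f⟩ := η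
  refine congrArg (TotalSpace.mk x) ?_
  refine ContinuousAlternatingMap.ext fun v => ?_
  exact congrArg f (funext fun i => DFunLike.congr_fun h (v i))

theorem autK_mul (g g' : AutX d X) (η : CanonicalBundle d X) :
    autK (g * g') η = autK g (autK g' η) := by
  obtain ⟨x, f⟩ := η
  refine congrArg (TotalSpace.mk (g (g' x))) ?_
  refine ContinuousAlternatingMap.ext fun v => ?_
  refine congrArg f (funext fun i => ?_)
  have h1 : mfderiv 𝓘(ℂ, Fin d → ℂ) 𝓘(ℂ, Fin d → ℂ) (g * g' : AutX d X) x =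
      (mfderiv 𝓘(ℂ, Fin d → ℂ) 𝓘(ℂ, Fin d → ℂ) g (g' x)).comp
        (mfderiv 𝓘(ℂ, Fin d → ℂ) 𝓘(ℂ, Fin d → ℂ) g' x) :=
    mfderiv_comp x (mdifferentiableAt_aut g (g' x)) (mdifferentiableAt_aut g' x)
  exact (DFunLike.congr_fun (congrArg ContinuousLinearMap.inverse h1) (v i)).trans
    (isInvertible_mfderiv_aut g' x).inverse_comp_apply_of_right

theorem fibreCoord_actK (h : ℂˣ) (η : CanonicalBundle d X) :
    fibreCoord w (actK h η) = ((h⁻¹ : ℂˣ) : ℂ) * fibreCoord w η := rfl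

/-- The inverse differential of `g` carries the frame of `f` to that of `f ∘ g`. Keeping `f ∘ g` as
a plain map suits the families in `contMDiffAt_apply_frame`. -/
theorem fibreCoord_autK (g : AutX d X) {f : OpenPartialHomeomorph X (Fin d → ℂ)}
    {η : CanonicalBundle d X}
    (hf : MDifferentiableAt 𝓘(ℂ, Fin d → ℂ) 𝓘(ℂ, Fin d → ℂ) f (g η.1)) :
    fibreCoord f (autK g η) = η.2 fun i =>
      (mfderiv 𝓘(ℂ, Fin d → ℂ) 𝓘(ℂ, Fin d → ℂ) (f ∘ g) η.1).inverse
        (Pi.single i (1 : ℂ) : Fin d → ℂ) := by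
  change η.2 (fun i => (mfderiv 𝓘(ℂ, Fin d → ℂ) 𝓘(ℂ, Fin d → ℂ) g η.1).inverse
    (coordVec f i (g η.1))) = _
  congr 1
  funext i
  exact (inverse_mfderiv_comp_aut g hf _).symm

theorem fibreCoord_autK_eq_pullChart (g : AutX d X)
    (hw : w ∈ IsManifold.maximalAtlas 𝓘(ℂ, Fin d → ℂ) ω X) {η : CanonicalBundle d X}
    (h : g η.1 ∈ w.source) : fibreCoord w (autK g η) = fibreCoord (pullChart g w) η :=
  fibreCoord_autK g ((mdifferentiable_of_mem_maximalAtlas hw).mdifferentiableAt h)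

variable [IsManifold 𝓘(ℂ, Fin d → ℂ) ω X]

theorem pullChart_mem_maximalAtlas (g : AutX d X)
    (hw : w ∈ IsManifold.maximalAtlas 𝓘(ℂ, Fin d → ℂ) ω X) :
    pullChart g w ∈ IsManifold.maximalAtlas 𝓘(ℂ, Fin d → ℂ) ω X := by
  refine OpenPartialHomeomorph.mem_maximalAtlas_of_contMDiffOn _ ?_ ?_
  · exact (contMDiffOn_of_mem_maximalAtlas hw).comp g.contMDiff.contMDiffOn fun x hx => hx
  · exact g.symm.contMDiff.comp_contMDiffOn (contMDiffOn_symm_of_mem_maximalAtlas hw)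

section Smooth

variable {EN HN : Type*} [NormedAddCommGroup EN] [NormedSpace ℂ EN] [TopologicalSpace HN]
  {J : ModelWithCorners ℂ EN HN} {N : Type*} [TopologicalSpace N] [ChartedSpace HN N]

/-- A holomorphic family of automorphisms acts holomorphically on `K_X`. -/
theorem contMDiffAt_autK [IsManifold J 1 N] {g : N → AutX d X} {κ : N → CanonicalBundle d X}
    {n₀ : N} (hκ : ContMDiffAt J (IK d) ω κ n₀)
    (hg : ContMDiffAt (J.prod 𝓘(ℂ, Fin d → ℂ)) 𝓘(ℂ, Fin d → ℂ) ω (fun p : N × X => g p.1 p.2)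
      (n₀, (κ n₀).1)) :
    ContMDiffAt J (IK d) ω (fun n => autK (g n) (κ n)) n₀ := by
  have hκ₁ : ContMDiffAt J 𝓘(ℂ, Fin d → ℂ) ω (fun n => (κ n).1) n₀ :=
    (contMDiffAt_totalSpace.1 hκ).1
  have hb : ContMDiffAt J 𝓘(ℂ, Fin d → ℂ) ω (fun n => g n (κ n).1) n₀ :=
    hg.comp n₀ (contMDiffAt_id.prodMk hκ₁)
  let φ := chartAt (Fin d → ℂ) (g n₀ (κ n₀).1)
  have hφ : φ ∈ IsManifold.maximalAtlas 𝓘(ℂ, Fin d → ℂ) ω X := IsManifold.chart_mem_maximalAtlas _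
  have hφs : g n₀ (κ n₀).1 ∈ φ.source := mem_chart_source _ _
  refine contMDiffAt_canonicalBundle hb ?_
  -- Joint holomorphy of the family is essential here: the frame depends on the derivative of `φ ∘ g
  -- n` in the base variable.
  refine (contMDiffAt_apply_frame (f := fun n => φ ∘ g n) hκ
    ((contMDiffAt_of_mem_maximalAtlas hφ hφs).comp (n₀, (κ n₀).1) hg)
    (isInvertible_mfderiv_of_mem_maximalAtlas (pullChart_mem_maximalAtlas (g n₀) hφ)
      hφs)).congr_of_eventuallyEq ?_
  filter_upwards [hb.continuousAt.preimage_mem_nhds (φ.open_source.mem_nhds hφs)] with n hn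
  exact fibreCoord_autK (g n) ((mdifferentiable_of_mem_maximalAtlas hφ).mdifferentiableAt hn)

theorem contMDiffAt_actK {h : N → ℂˣ} {κ : N → CanonicalBundle d X}
    {n₀ : N} (hκ : ContMDiffAt J (IK d) ω κ n₀) (hh : ContMDiffAt J 𝓘(ℂ, ℂ) ω h n₀) :
    ContMDiffAt J (IK d) ω (fun n => actK (h n) (κ n)) n₀ := by
  refine contMDiffAt_canonicalBundle (contMDiffAt_totalSpace.1 hκ).1 ?_
  have h1 : ContMDiffAt J 𝓘(ℂ, ℂ) ω (fun n => (((h n)⁻¹ : ℂˣ) : ℂ)) n₀ :=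
    (Units.contMDiff_val (R := ℂ) (𝕜 := ℂ)).contMDiffAt.comp n₀ hh.inv
  exact h1.smul ((contMDiffAt_fibreCoord (IsManifold.chart_mem_maximalAtlas _)
    (mem_chart_source _ _)).comp n₀ hκ)

theorem contMDiffAt_units_iff {f : N → ℂˣ} {n₀ : N} {m : ℕ∞ω} :
    ContMDiffAt J 𝓘(ℂ, ℂ) m f n₀ ↔ ContMDiffAt J 𝓘(ℂ, ℂ) m (fun n => (f n : ℂ)) n₀ := by
  refine ⟨fun h => (Units.contMDiff_val (R := ℂ) (𝕜 := ℂ)).contMDiffAt.comp n₀ h, fun h => ?_⟩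
  rw [contMDiffAt_iff] at h ⊢
  exact ⟨Units.isOpenEmbedding_val.isInducing.continuousAt_iff.2 h.1, h.2⟩

end Smooth

theorem mdifferentiableAt_autK (g : AutX d X) (η : CanonicalBundle d X) :
    MDifferentiableAt (IK d) (IK d) (autK g) η :=
  (contMDiffAt_autK (g := fun _ => g) (κ := id) contMDiffAt_id
    (g.contMDiff.contMDiffAt.comp (η, η.1) contMDiffAt_snd)).mdifferentiableAt (by simp)

theorem mdifferentiableAt_actK (h : ℂˣ) (η : CanonicalBundle d X) :
    MDifferentiableAt (IK d) (IK d) (actK h) η :=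
  (contMDiffAt_actK (h := fun _ => h) (κ := id) contMDiffAt_id
    contMDiffAt_const).mdifferentiableAt (by simp)

theorem pullback_autK_localForm (g : AutX d X)
    (hw : w ∈ IsManifold.maximalAtlas 𝓘(ℂ, Fin d → ℂ) ω X) {η : CanonicalBundle d X}
    (h : g η.1 ∈ w.source) :
    pullback (IK d) (IK d) (autK g) (localForm w) η = localForm (pullChart g w) η := by
  have hπ : ContinuousAt (fun ζ : CanonicalBundle d X => g ζ.1) η :=
    g.continuous.continuousAt.comp
      (contMDiffAt_proj (n := 1) (IB := 𝓘(ℂ, Fin d → ℂ)) _).continuousAt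
  have hc : ∀ i, bundleCoord w i ∘ autK g =ᶠ[𝓝 η] bundleCoord (pullChart g w) i := by
    intro i
    filter_upwards [hπ.preimage_mem_nhds (w.open_source.mem_nhds h)] with ζ hζ
    refine Fin.cases ?_ (fun i => ?_) i
    · exact fibreCoord_autK_eq_pullChart g hw hζ
    · rfl
  rw [localForm_eq_dWedge, localForm_eq_dWedge, pullback_dWedge
    (fun i => mdifferentiableAt_bundleCoord hw (η := autK g η) h i) (mdifferentiableAt_autK g η)]
  exact dWedge_congr hc

/-- Moving a chart by `g` gives another holomorphic chart, and the form does not see which chart is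
used. -/
theorem pullback_autK_canonicalForm (g : AutX d X) (η : CanonicalBundle d X) :
    pullback (IK d) (IK d) (autK g) canonicalForm η = canonicalForm η := by
  have hφ : chartAt (Fin d → ℂ) (g η.1) ∈ IsManifold.maximalAtlas 𝓘(ℂ, Fin d → ℂ) ω X :=
    IsManifold.chart_mem_maximalAtlas _
  have hφs : g η.1 ∈ (chartAt (Fin d → ℂ) (g η.1)).source := mem_chart_source _ _
  rw [canonicalForm_eq_localForm (pullChart_mem_maximalAtlas g hφ) η hφs,
    pullback_congr (canonicalForm_eq_localForm hφ (autK g η) hφs),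
    pullback_autK_localForm g hφ hφs]

theorem pullback_actK_localForm (h : ℂˣ)
    (hw : w ∈ IsManifold.maximalAtlas 𝓘(ℂ, Fin d → ℂ) ω X) {η : CanonicalBundle d X}
    (hη : η.1 ∈ w.source) :
    pullback (IK d) (IK d) (actK h) (localForm w) η = ((h⁻¹ : ℂˣ) : ℂ) • localForm w η := by
  have h1 : mvfderiv (IK d) (((h⁻¹ : ℂˣ) : ℂ) • fibreCoord w) η =
      ((h⁻¹ : ℂˣ) : ℂ) • mvfderiv (IK d) (fibreCoord w) η := by
    unfold mvfderiv
    rw [const_smul_mfderiv (f := fibreCoord w) (mdifferentiableAt_bundleCoord hw hη 0)]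
    rfl
  rw [localForm_apply, ← wedge_cons_smul, ← h1, localForm_eq_dWedge, pullback_dWedge
    (fun i => mdifferentiableAt_bundleCoord hw (η := actK h η) hη i) (mdifferentiableAt_actK h η)]
  unfold dWedge
  congr 1
  funext i
  refine Fin.cases ?_ (fun i => ?_) i <;> rfl

theorem pullback_actK_canonicalForm (h : ℂˣ) (η : CanonicalBundle d X) :
    pullback (IK d) (IK d) (actK h) canonicalForm η =
      ((h⁻¹ : ℂˣ) : ℂ) • canonicalForm η := by
  have hφ : chartAt (Fin d → ℂ) η.1 ∈ IsManifold.maximalAtlas 𝓘(ℂ, Fin d → ℂ) ω X :=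
    IsManifold.chart_mem_maximalAtlas _
  have hφs : η.1 ∈ (chartAt (Fin d → ℂ) η.1).source := mem_chart_source _ _
  rw [canonicalForm_eq_localForm hφ η hφs,
    pullback_congr (canonicalForm_eq_localForm hφ (actK h η) hφs),
    pullback_actK_localForm h hφ hφs]

end Actions

/-! ### The principal bundle `K_X^×` and the restricted form -/

section KX

variable {d : ℕ} {X : Type*} [TopologicalSpace X] [ChartedSpace (Fin d → ℂ) X]
  [IsManifold 𝓘(ℂ, Fin d → ℂ) ω X] {w : OpenPartialHomeomorph X (Fin d → ℂ)}

theorem contMDiff_val_KX {n : ℕ∞ω} :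
    ContMDiff (IK d) (IK d) n (Subtype.val : KX d X → CanonicalBundle d X) :=
  contMDiff_subtype_val

theorem mdifferentiableAt_val_KX (η : KX d X) :
    MDifferentiableAt (IK d) (IK d) (Subtype.val : KX d X → CanonicalBundle d X) η :=
  (contMDiff_val_KX (n := 1)).mdifferentiableAt one_ne_zero

theorem contMDiff_projKX {n : ℕ∞ω} (hn : n ≤ ω) :
    ContMDiff (IK d) 𝓘(ℂ, Fin d → ℂ) n (projKX (d := d) (X := X)) :=
  ((contMDiff_proj (n := ω) (IB := 𝓘(ℂ, Fin d → ℂ)) _).comp contMDiff_val_KX).of_le hn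

/-- A zero of `z_w` is a zero of the preferred fibre coordinate, and that one determines the form.
-/
theorem fibreCoord_ne_zero (hw : w ∈ IsManifold.maximalAtlas 𝓘(ℂ, Fin d → ℂ) ω X) {η : KX d X}
    (h : projKX η ∈ w.source) : fibreCoord w η.1 ≠ 0 := by
  intro h0
  have hφs : η.1.1 ∈ (chartAt (Fin d → ℂ) η.1.1).source := mem_chart_source _ _
  have h1 : fibreCoord (chartAt (Fin d → ℂ) η.1.1) η.1 = 0 := by
    rw [fibreCoord_eq_mul hw h, h0, mul_zero]
  rw [fibreCoord_chartAt hφs] at h1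
  refine η.2 ?_
  have h2 : (trivializationAt (FormModel (Fin d → ℂ) d)
      (fun x : X => FormFiber 𝓘(ℂ, Fin d → ℂ) d x) η.1.1 η.1).2 = 0 :=
    (evalStd d).map_eq_zero_iff.1 h1
  have hb : η.1.1 ∈ (trivializationAt (FormModel (Fin d → ℂ) d)
      (fun x : X => FormFiber 𝓘(ℂ, Fin d → ℂ) d x) η.1.1).baseSet :=
    FiberBundle.mem_baseSet_trivializationAt' _
  exact (Trivialization.continuousLinearEquivAt ℂ _ _ hb).map_eq_zero_iff.1 h2

theorem ofCoord_snd_ne_zero {x₀ : X} {p : X × ℂ} (h : p.1 ∈ (chartAt (Fin d → ℂ) x₀).source)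
    (hp : p.2 ≠ 0) : (ofCoord (d := d) x₀ p).2 ≠ 0 := by
  intro h0
  apply hp
  rw [← fibreCoord_ofCoord h]
  unfold fibreCoord
  rw [h0]
  rfl

open Classical in
/-- The local trivialization of `K_X^×` given by the preferred chart at `x₀`. -/
def toTriv (x₀ : X) (η : KX d X) : X × ℂˣ :=
  -- The value `1` never occurs over the chart domain.
  (projKX η, if h : fibreCoord (chartAt (Fin d → ℂ) x₀) η.1 ≠ 0 then Units.mk0 _ h else 1)

open Classical in
/-- The inverse of the local trivialization of `K_X^×` given by the preferred chart at `x₀`. -/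
def ofTriv (x₀ : X) (p : X × ℂˣ) : KX d X :=
  if h : (ofCoord (d := d) x₀ (p.1, (p.2 : ℂ))).2 ≠ 0 then ⟨_, h⟩ else
    -- An arbitrary nonzero form, making the map total; not reached over the chart domain.
    ⟨ofCoord (d := d) x₀ (x₀, 1), ofCoord_snd_ne_zero (mem_chart_source _ _) one_ne_zero⟩

variable {x₀ : X}

theorem toTriv_snd {η : KX d X} (hη : projKX η ∈ (chartAt (Fin d → ℂ) x₀).source) :
    ((toTriv x₀ η).2 : ℂ) = fibreCoord (chartAt (Fin d → ℂ) x₀) η.1 := by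
  have h := fibreCoord_ne_zero (IsManifold.chart_mem_maximalAtlas x₀) hη
  exact congrArg Units.val (dif_pos h)

theorem ofTriv_val {p : X × ℂˣ} (hp : p.1 ∈ (chartAt (Fin d → ℂ) x₀).source) :
    (ofTriv (d := d) x₀ p).1 = ofCoord x₀ (p.1, (p.2 : ℂ)) :=
  congrArg Subtype.val
    (dif_pos (ofCoord_snd_ne_zero (d := d) (p := (p.1, (p.2 : ℂ))) hp p.2.ne_zero))

theorem isOpen_preimage_projKX (x₀ : X) :
    IsOpen (projKX (d := d) ⁻¹' (chartAt (Fin d → ℂ) x₀).source) :=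
  (chartAt (Fin d → ℂ) x₀).open_source.preimage (contMDiff_projKX (n := ω) le_rfl).continuous

theorem contMDiffOn_toTriv (x₀ : X) :
    ContMDiffOn (IK d) (𝓘(ℂ, Fin d → ℂ).prod 𝓘(ℂ, ℂ)) ω (toTriv (d := d) x₀)
      (projKX ⁻¹' (chartAt (Fin d → ℂ) x₀).source) := by
  intro η hη
  refine ContMDiffAt.contMDiffWithinAt
    ((contMDiff_projKX le_rfl).contMDiffAt.prodMk (contMDiffAt_units_iff.2 ?_))
  refine ((contMDiffAt_fibreCoord (IsManifold.chart_mem_maximalAtlas x₀) hη).comp η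
    contMDiff_val_KX.contMDiffAt).congr_of_eventuallyEq ?_
  filter_upwards [(isOpen_preimage_projKX x₀).mem_nhds hη] with ζ hζ
  exact toTriv_snd hζ

theorem contMDiffOn_ofTriv (x₀ : X) :
    ContMDiffOn (𝓘(ℂ, Fin d → ℂ).prod 𝓘(ℂ, ℂ)) (IK d) ω (ofTriv (d := d) x₀)
      ((chartAt (Fin d → ℂ) x₀).source ×ˢ univ) := by
  intro p hp
  refine ContMDiffAt.contMDiffWithinAt (contMDiffAt_opens_iff.2 ?_)
  have h1 : ContMDiffAt (𝓘(ℂ, Fin d → ℂ).prod 𝓘(ℂ, ℂ)) (𝓘(ℂ, Fin d → ℂ).prod 𝓘(ℂ, ℂ)) ω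
      (fun q : X × ℂˣ => (q.1, (q.2 : ℂ))) p :=
    contMDiffAt_fst.prodMk (contMDiffAt_units_iff.1 contMDiffAt_snd)
  refine ((contMDiffAt_ofCoord (p := (p.1, (p.2 : ℂ))) hp.1).comp p h1).congr_of_eventuallyEq ?_
  filter_upwards [continuousAt_fst.preimage_mem_nhds
    ((chartAt (Fin d → ℂ) x₀).open_source.mem_nhds hp.1)] with q hq
  exact ofTriv_val hq

/-- The local trivialization of `K_X^×` given by the preferred chart at `x₀`. -/
def trivKX (x₀ : X) : OpenPartialHomeomorph (KX d X) (X × ℂˣ) where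
  toFun := toTriv x₀
  invFun := ofTriv x₀
  source := projKX ⁻¹' (chartAt (Fin d → ℂ) x₀).source
  target := (chartAt (Fin d → ℂ) x₀).source ×ˢ univ
  map_source' η hη := ⟨hη, mem_univ _⟩
  map_target' p hp := by
    rw [mem_preimage, projKX, ofTriv_val hp.1, ofCoord_fst (p := (p.1, (p.2 : ℂ))) hp.1]
    exact hp.1
  left_inv' η hη := by
    refine Subtype.ext ((ofTriv_val (p := toTriv x₀ η) hη).trans ?_)
    rw [toTriv_snd hη]
    exact ofCoord_fibreCoord hη
  right_inv' p hp := by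
    have h1 : projKX (ofTriv (d := d) x₀ p) = p.1 := by
      rw [projKX, ofTriv_val hp.1, ofCoord_fst (p := (p.1, (p.2 : ℂ))) hp.1]
    refine Prod.ext h1 (Units.ext ?_)
    rw [toTriv_snd (by rw [h1]; exact hp.1), ofTriv_val hp.1]
    exact fibreCoord_ofCoord (p := (p.1, (p.2 : ℂ))) hp.1
  open_source := isOpen_preimage_projKX x₀
  open_target := (chartAt (Fin d → ℂ) x₀).open_source.prod isOpen_univ
  continuousOn_toFun := (contMDiffOn_toTriv x₀).continuousOn
  continuousOn_invFun := (contMDiffOn_ofTriv x₀).continuousOn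

theorem isHolomorphicAction_actKX :
    IsHolomorphicAction (IK d) 𝓘(ℂ, ℂ) (actKX (d := d) (X := X)) where
  one_act η := by
    refine Subtype.ext (congrArg (TotalSpace.mk η.1.1) ?_)
    rw [inv_one, Units.val_one, one_smul]
  mul_act h h' η := by
    refine Subtype.ext (congrArg (TotalSpace.mk η.1.1) ?_)
    rw [mul_inv_rev, Units.val_mul, mul_comm, mul_smul]
    rfl
  holomorphic p := contMDiffAt_opens_iff.2
    (contMDiffAt_actK (contMDiff_val_KX.contMDiffAt.comp p contMDiffAt_snd) contMDiffAt_fst)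

theorem isPrincipalBundle_KX :
    IsPrincipalBundle (IK d) 𝓘(ℂ, Fin d → ℂ) 𝓘(ℂ, ℂ) (projKX (d := d) (X := X)) actKX where
  action := isHolomorphicAction_actKX
  holomorphic_proj := contMDiff_projKX le_rfl
  proj_act _ _ := rfl
  locally_trivial x := by
    refine ⟨(chartAt (Fin d → ℂ) x).source, trivKX x, (chartAt (Fin d → ℂ) x).open_source,
      mem_chart_source _ _, rfl, rfl, contMDiffOn_toTriv x, contMDiffOn_ofTriv x,
      fun _ _ => rfl, fun η hη h => Units.ext ?_⟩
    -- The left action of `h` multiplies the fibre coordinate by `h⁻¹`, as local triviality demands.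
    refine (toTriv_snd (η := actKX h η) hη).trans ?_
    refine (fibreCoord_actK h η.1).trans ?_
    rw [mul_comm, Units.val_mul]
    exact congrArg (· * _) (toTriv_snd hη).symm

theorem contMDiff_autKX (g : AutX d X) : ContMDiff (IK d) (IK d) ω (autKX g) := fun η =>
  contMDiffAt_opens_iff.2 (contMDiffAt_autK (g := fun _ => g) (κ := Subtype.val)
    contMDiff_val_KX.contMDiffAt
    (g.contMDiff.contMDiffAt.comp (η, η.1.1) contMDiffAt_snd))

/-- Stated for a homomorphism into `Aut X` so that `Aut X` itself and any group acting through it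
are covered at once. -/
theorem isEquivariantPrincipalBundle_KX {G : Type*} [Group G] (a : G →* AutX d X) :
    IsEquivariantPrincipalBundle (IK d) 𝓘(ℂ, Fin d → ℂ) 𝓘(ℂ, ℂ) (projKX (d := d) (X := X)) actKX
      (fun g : G => autKX (a g)) (fun g x => a g x) where
  principal := isPrincipalBundle_KX
  one_act η := Subtype.ext (by rw [map_one]; exact autK_one η.1)
  mul_act g g' η := Subtype.ext (by rw [map_mul]; exact autK_mul (a g) (a g') η.1)
  holomorphic_act g := contMDiff_autKX (a g)
  comm _ _ _ := rfl
  proj_actG _ _ := rfl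

theorem isHolomorphicAction_autKX {EG HG G : Type*} [NormedAddCommGroup EG] [NormedSpace ℂ EG]
    [TopologicalSpace HG] {IG : ModelWithCorners ℂ EG HG} [TopologicalSpace G] [ChartedSpace HG G]
    [Group G] [IsManifold IG 1 G] (a : G →* AutX d X)
    (ha : ContMDiff (IG.prod 𝓘(ℂ, Fin d → ℂ)) 𝓘(ℂ, Fin d → ℂ) ω (fun p : G × X => a p.1 p.2)) :
    IsHolomorphicAction (IK d) IG (fun g : G => autKX (a g)) where
  one_act η := Subtype.ext (by rw [map_one]; exact autK_one η.1)
  mul_act g g' η := Subtype.ext (by rw [map_mul]; exact autK_mul (a g) (a g') η.1)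
  holomorphic p := contMDiffAt_opens_iff.2 (contMDiffAt_autK
    (g := fun q : G × KX d X => a q.1) (κ := fun q => q.2.1)
    (contMDiff_val_KX.contMDiffAt.comp p contMDiffAt_snd)
    (ha.contMDiffAt.comp (p, p.2.1.1)
      ((contMDiffAt_fst.comp _ contMDiffAt_fst).prodMk contMDiffAt_snd)))

theorem canonicalFormKX_eq_dWedge (hw : w ∈ IsManifold.maximalAtlas 𝓘(ℂ, Fin d → ℂ) ω X)
    {η : KX d X} (h : projKX η ∈ w.source) :
    canonicalFormKX η = dWedge (IK d) (fun i => bundleCoord w i ∘ Subtype.val) η := by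
  rw [canonicalFormKX, pullback_congr (canonicalForm_eq_localForm hw η.1 h), localForm_eq_dWedge]
  exact pullback_dWedge (fun i => mdifferentiableAt_bundleCoord hw h i) (mdifferentiableAt_val_KX η)

theorem contMDiffAt_bundleCoord_KX (hw : w ∈ IsManifold.maximalAtlas 𝓘(ℂ, Fin d → ℂ) ω X)
    {η : KX d X} (h : projKX η ∈ w.source) (i : Fin (d + 1)) :
    ContMDiffAt (IK d) 𝓘(ℂ, ℂ) ω (bundleCoord w i ∘ (Subtype.val : KX d X → _)) η :=
  (contMDiffAt_bundleCoord hw h i).comp η contMDiff_val_KX.contMDiffAt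

theorem isHolomorphicForm_canonicalFormKX :
    IsHolomorphicForm (IK d) (canonicalFormKX (d := d) (X := X)) := by
  intro η
  have hφ : chartAt (Fin d → ℂ) (projKX η) ∈ IsManifold.maximalAtlas 𝓘(ℂ, Fin d → ℂ) ω X :=
    IsManifold.chart_mem_maximalAtlas _
  refine (contMDiffAt_dWedge fun i => contMDiffAt_bundleCoord_KX hφ
    (mem_chart_source _ (projKX η)) i).congr_of_eventuallyEq ?_
  filter_upwards [(isOpen_preimage_projKX (projKX η)).mem_nhds (mem_chart_source _ _)] with ζ hζ
  rw [canonicalFormKX_eq_dWedge hφ hζ]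

/-- The chain rule applied to `val ∘ F = F' ∘ val`; it transfers the transformation laws from `K_X`
to `K_X^×`. -/
theorem pullback_val_commute {F : KX d X → KX d X}
    {F' : CanonicalBundle d X → CanonicalBundle d X} {η : KX d X}
    (hF : MDifferentiableAt (IK d) (IK d) F η) (hF' : MDifferentiableAt (IK d) (IK d) F' η.1)
    (h : ∀ ζ, (F ζ).1 = F' ζ.1) :
    pullback (IK d) (IK d) F canonicalFormKX η =
      (pullback (IK d) (IK d) F' canonicalForm η.1).compContinuousLinearMap
        (mfderiv (IK d) (IK d) (Subtype.val : KX d X → CanonicalBundle d X) η) := by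
  have h1 := mfderiv_comp η (mdifferentiableAt_val_KX (F η)) hF
  have h2 := mfderiv_comp η hF' (mdifferentiableAt_val_KX η)
  have h3 : (Subtype.val : KX d X → CanonicalBundle d X) ∘ F = F' ∘ Subtype.val := funext h
  rw [h3] at h1
  have h4 := h1.symm.trans h2
  refine ContinuousAlternatingMap.ext fun v => ?_
  change canonicalForm (F η).1 (fun i => mfderiv (IK d) (IK d) Subtype.val (F η)
    (mfderiv (IK d) (IK d) F η (v i))) = canonicalForm (F' η.1) (fun i =>
    mfderiv (IK d) (IK d) F' η.1 (mfderiv (IK d) (IK d) Subtype.val η (v i)))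
  rw [← h η]
  exact congrArg _ (funext fun i => DFunLike.congr_fun h4 (v i))

end KX

/-! ### The CY structure and its contraction with `x₀` -/

section CY

variable {d : ℕ} {X : Type*} [TopologicalSpace X] [ChartedSpace (Fin d → ℂ) X]
  [IsManifold 𝓘(ℂ, Fin d → ℂ) ω X] {w : OpenPartialHomeomorph X (Fin d → ℂ)}

theorem mdifferentiableAt_autKX (g : AutX d X) (η : KX d X) :
    MDifferentiableAt (IK d) (IK d) (autKX g) η :=
  (contMDiff_autKX g).mdifferentiableAt (by simp)

theorem mdifferentiableAt_actKX (h : ℂˣ) (η : KX d X) :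
    MDifferentiableAt (IK d) (IK d) (actKX h) η :=
  ((contMDiffAt_opens_iff.2 (contMDiffAt_actK contMDiff_val_KX.contMDiffAt contMDiffAt_const) :
    ContMDiffAt (IK d) (IK d) ω (actKX h) η)).mdifferentiableAt (by simp)

theorem pullback_autKX_canonicalFormKX (g : AutX d X) (η : KX d X) :
    pullback (IK d) (IK d) (autKX g) canonicalFormKX η = canonicalFormKX η := by
  rw [pullback_val_commute (F' := autK g) (mdifferentiableAt_autKX g η)
    (mdifferentiableAt_autK g η.1) (fun _ => rfl), pullback_autK_canonicalForm]
  rfl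

theorem pullback_actKX_canonicalFormKX (h : ℂˣ) (η : KX d X) :
    pullback (IK d) (IK d) (actKX h) canonicalFormKX η =
      ((h⁻¹ : ℂˣ) : ℂ) • canonicalFormKX η := by
  rw [pullback_val_commute (F' := actK h) (mdifferentiableAt_actKX h η)
    (mdifferentiableAt_actK h η.1) (fun _ => rfl), pullback_actK_canonicalForm]
  rfl

theorem canonicalFormKX_ne_zero (η : KX d X) : canonicalFormKX η ≠ 0 :=
  compContinuousLinearMap_ne_zero (canonicalForm_ne_zero η.1) (mfderiv_subtype_val_surjective η)

theorem isCYStructure_canonicalFormKX :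
    IsCYStructure (IK d) 𝓘(ℂ, ℂ) actKX (canonicalFormKX (d := d) (X := X)) (MonoidHom.id ℂˣ) where
  top_degree := by
    rw [Module.finrank_prod, finrank_formModel, Module.finrank_fin_fun]
  holomorphic := isHolomorphicForm_canonicalFormKX
  nowhere_zero := canonicalFormKX_ne_zero
  holomorphic_character := contMDiff_id
  -- `Γ_h` pulls back along the action of `h⁻¹`, which itself scales by the inverse of `h⁻¹`; the
  -- factor is `h`.
  transform h := funext fun η => (pullback_actKX_canonicalFormKX h⁻¹ η).trans (by
    rw [inv_inv]
    rfl)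

theorem isEquivariantCYStructure_canonicalFormKX {G : Type*} [Group G] (a : G →* AutX d X) :
    IsEquivariantCYStructure (IK d) 𝓘(ℂ, Fin d → ℂ) 𝓘(ℂ, ℂ) (projKX (d := d) (X := X)) actKX
      (fun g : G => autKX (a g)) (fun g x => a g x) canonicalFormKX (MonoidHom.id ℂˣ) where
  bundle := isEquivariantPrincipalBundle_KX a
  cy := isCYStructure_canonicalFormKX
  invariant g := funext fun η => pullback_autKX_canonicalFormKX (a g⁻¹) η

theorem actKX_expUnit_zero (a : ℂ) (η : KX d X) : actKX (expUnit (0 * a)) η = η := by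
  have h : expUnit (0 * a) = 1 := Units.ext (by simp [expUnit])
  rw [h]
  exact isHolomorphicAction_actKX.one_act η

/-- The derivative of a function along a vector field generated by the action of `ℂˣ`. -/
theorem mvfderiv_generatedField {f : KX d X → ℂ} {η : KX d X}
    (hf : MDifferentiableAt (IK d) 𝓘(ℂ, ℂ) f η) (a : ℂ) :
    mvfderiv (IK d) f η (generatedField (IK d) actKX a η) =
      deriv (fun t : ℂ => f (actKX (expUnit (t * a)) η)) 0 := by
  have hu : ContMDiffAt 𝓘(ℂ, ℂ) 𝓘(ℂ, ℂ) ω (fun t : ℂ => expUnit (t * a)) 0 := by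
    refine contMDiffAt_units_iff.2 (ContDiffAt.contMDiffAt ?_)
    exact (Complex.contDiff_exp.comp (contDiff_id.mul contDiff_const)).contDiffAt
  have hc : MDifferentiableAt 𝓘(ℂ, ℂ) (IK d)
      (fun t : ℂ => actKX (expUnit (t * a)) η) 0 :=
    ((contMDiffAt_opens_iff.2 (contMDiffAt_actK contMDiffAt_const hu) :
      ContMDiffAt 𝓘(ℂ, ℂ) (IK d) ω (fun t : ℂ => actKX (expUnit (t * a)) η) 0)).mdifferentiableAt
        (by simp)
  have h1 := mvfderiv_comp_apply_of_eq (0 : ℂ) hf hc (actKX_expUnit_zero a η) (1 : ℂ)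
  refine h1.symm.trans ?_
  unfold mvfderiv
  rw [mfderiv_eq_fderiv]
  exact fderiv_apply_one_eq_deriv (𝕜 := ℂ) (F := ℂ)
    (f := fun t : ℂ => f (actKX (expUnit (t * a)) η)) (x := 0)

/-- Along the orbit `z_w` equals `exp (-t a)` times its initial value, the sign coming from the left
action. -/
theorem mvfderiv_fibreCoord_generatedField
    (hw : w ∈ IsManifold.maximalAtlas 𝓘(ℂ, Fin d → ℂ) ω X) {η : KX d X} (h : projKX η ∈ w.source)
    (a : ℂ) :
    mvfderiv (IK d) (bundleCoord w 0 ∘ (Subtype.val : KX d X → _)) η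
      (generatedField (IK d) actKX a η) = -a * fibreCoord w η.1 := by
  rw [mvfderiv_generatedField
    ((contMDiffAt_bundleCoord_KX hw h 0).mdifferentiableAt (by simp)) a]
  have h1 : (fun t : ℂ => (bundleCoord w 0 ∘ (Subtype.val : KX d X → _))
      (actKX (expUnit (t * a)) η)) = fun t => Complex.exp (t * -a) * fibreCoord w η.1 := by
    funext t
    refine (fibreCoord_actK _ η.1).trans ?_
    rw [mul_neg, Complex.exp_neg, Units.val_inv_eq_inv_val]
    rfl
  rw [h1]
  simp

/-- Orbits stay in one fibre, so base coordinates are constant along them. -/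
theorem mvfderiv_baseCoord_generatedField
    (hw : w ∈ IsManifold.maximalAtlas 𝓘(ℂ, Fin d → ℂ) ω X) {η : KX d X} (h : projKX η ∈ w.source)
    (a : ℂ) (i : Fin d) :
    mvfderiv (IK d) (fun ξ : KX d X => w (projKX ξ) i) η
      (generatedField (IK d) actKX a η) = 0 := by
  refine (mvfderiv_generatedField
    ((contMDiffAt_bundleCoord_KX hw h i.succ).mdifferentiableAt (by simp)) a).trans ?_
  exact deriv_const (0 : ℂ) (w (projKX η) i)

/-- The contraction of the canonical form with `x₀` in coordinates. -/
theorem contract_canonicalFormKX (hw : w ∈ IsManifold.maximalAtlas 𝓘(ℂ, Fin d → ℂ) ω X)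
    (η : KX d X) (h : projKX η ∈ w.source) :
    contract (IK d) x₀ canonicalFormKX η =
      fibreCoord w η.1 • dWedge (IK d) (fun i (ξ : KX d X) => w (projKX ξ) i) η := by
  have e : canonicalFormKX η = wedge (Fin.cons
      (mvfderiv (IK d) (bundleCoord w 0 ∘ (Subtype.val : KX d X → _)) η)
      fun i => mvfderiv (IK d) (fun ξ : KX d X => w (projKX ξ) i) η) := by
    rw [canonicalFormKX_eq_dWedge hw h]
    unfold dWedge
    congr 1
    funext i
    refine Fin.cases ?_ (fun i => ?_) i <;> rfl
  have h1 := contractVec_wedge_cons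
    (mvfderiv (IK d) (bundleCoord w 0 ∘ (Subtype.val : KX d X → _)) η)
    (fun i => mvfderiv (IK d) (fun ξ : KX d X => w (projKX ξ) i) η) (x₀ η)
    (fun i => mvfderiv_baseCoord_generatedField hw h (-1) i)
  have h2 : mvfderiv (IK d) (bundleCoord w 0 ∘ (Subtype.val : KX d X → _)) η (x₀ η) =
      -- The generator `-1` cancels the sign, so `x₀` differentiates `z_w` to itself.
      fibreCoord w η.1 := (mvfderiv_fibreCoord_generatedField hw h (-1)).trans (by ring)
  rw [h2] at h1
  rw [contract, e]
  exact h1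

/-- Locally the form is a holomorphic function times a wedge of holomorphic differentials, so
holomorphy of `x₀` is never needed. -/
theorem isHolomorphicForm_contract :
    IsHolomorphicForm (IK d) (contract (IK d) x₀ (canonicalFormKX (d := d) (X := X))) := by
  intro η
  have hφ : chartAt (Fin d → ℂ) (projKX η) ∈ IsManifold.maximalAtlas 𝓘(ℂ, Fin d → ℂ) ω X :=
    IsManifold.chart_mem_maximalAtlas _
  have hφs := mem_chart_source (Fin d → ℂ) (projKX η)
  have h1 := contMDiffAt_dWedge fun i : Fin d => contMDiffAt_bundleCoord_KX hφ hφs i.succ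
  refine ((contMDiffAt_bundleCoord_KX hφ hφs 0).smul_section h1).congr_of_eventuallyEq ?_
  filter_upwards [(isOpen_preimage_projKX (projKX η)).mem_nhds hφs] with ζ hζ
  rw [contract_canonicalFormKX hφ ζ hζ]
  rfl

/-- The local formulas in a chart `w` at the image point and in `w ∘ g` at `η` correspond term by
term, which avoids proving that `x₀` is invariant. -/
theorem pullback_autKX_contract (g : AutX d X) (η : KX d X) :
    pullback (IK d) (IK d) (autKX g) (contract (IK d) x₀ canonicalFormKX) η =
      contract (IK d) x₀ canonicalFormKX η := by
  have hφ : chartAt (Fin d → ℂ) (g (projKX η)) ∈ IsManifold.maximalAtlas 𝓘(ℂ, Fin d → ℂ) ω X :=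
    IsManifold.chart_mem_maximalAtlas _
  have hφs : projKX (autKX g η) ∈ (chartAt (Fin d → ℂ) (g (projKX η))).source :=
    mem_chart_source _ _
  have h1 := contract_canonicalFormKX hφ (autKX g η) hφs
  have h2 := contract_canonicalFormKX (pullChart_mem_maximalAtlas g hφ) η hφs
  have h3 : fibreCoord (chartAt (Fin d → ℂ) (g (projKX η))) (autKX g η).1 =
      fibreCoord (pullChart g (chartAt (Fin d → ℂ) (g (projKX η)))) η.1 :=
    fibreCoord_autK_eq_pullChart g hφ hφs
  have h4 := pullback_dWedge
    (f := fun i (ξ : KX d X) => chartAt (Fin d → ℂ) (g (projKX η)) (projKX ξ) i)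
    (fun i => (contMDiffAt_bundleCoord_KX hφ hφs i.succ).mdifferentiableAt (by simp))
    (mdifferentiableAt_autKX g η)
  rw [h2, ← h3]
  refine Eq.trans ?_ (congrArg (fun θ => _ • θ) h4)
  unfold pullback
  rw [h1]
  rfl

/-- Only differentials of base coordinates occur in the local formula, and they kill generated
fields: the determinant has a zero column. -/
theorem contract_canonicalFormKX_horizontal (a : ℂ) (η : KX d X)
    (v : Fin d → TangentSpace (IK d) η) (hv : ∃ i, v i = generatedField (IK d) actKX a η) :
    contract (IK d) x₀ canonicalFormKX η v = 0 := by
  obtain ⟨j, hj⟩ := hv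
  have hφ : chartAt (Fin d → ℂ) (projKX η) ∈ IsManifold.maximalAtlas 𝓘(ℂ, Fin d → ℂ) ω X :=
    IsManifold.chart_mem_maximalAtlas _
  have hφs := mem_chart_source (Fin d → ℂ) (projKX η)
  rw [contract_canonicalFormKX hφ η hφs, ContinuousAlternatingMap.smul_apply]
  refine (congrArg _ (wedge_apply_eq_zero j fun i => ?_)).trans (smul_zero _)
  rw [hj]
  exact mvfderiv_baseCoord_generatedField hφ hφs a i

end CY

end

end Calabi

theorem theorem5p2 (d : ℕ) (X : Type*) [TopologicalSpace X] [ChartedSpace (Fin d → ℂ) X]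
    [IsManifold 𝓘(ℂ, Fin d → ℂ) ω X] :
    -- `ω̂` is `dz_w ∧ dw₁ ∧ ⋯ ∧ dw_d` in every holomorphic chart `w` of `X`
    (∀ w ∈ IsManifold.maximalAtlas 𝓘(ℂ, Fin d → ℂ) ω X, ∀ η : CanonicalBundle d X,
      η.1 ∈ w.source → canonicalForm η = localForm w η) ∧
    -- `ω̂` is a nowhere vanishing holomorphic form on `K_X`
    IsHolomorphicForm (IK d) (canonicalForm (d := d) (X := X)) ∧
    (∀ η : CanonicalBundle d X, canonicalForm η ≠ 0) ∧
    -- `ω̂` is invariant under `Aut X`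
    (∀ g : AutX d X, Γ (IK d) autK g canonicalForm = canonicalForm) ∧
    -- `Γ_h ω̂ = h ω̂`
    (∀ h : ℂˣ, Γ (IK d) actK h (canonicalForm (d := d) (X := X)) =
      fun η => (h : ℂ) • canonicalForm η) ∧
    -- `(ω̂, χ₁)` is an `Aut X`-equivariant CY structure on `K_X^×`
    IsEquivariantCYStructure (IK d) 𝓘(ℂ, Fin d → ℂ) 𝓘(ℂ, ℂ) (projKX (d := d) (X := X)) actKX
      (autKX (d := d) (X := X)) (fun g x => g x) canonicalFormKX (MonoidHom.id ℂˣ) ∧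
    -- a complex Lie group acting holomorphically on `X` acts holomorphically on `K_X^×`, and
    -- `(ω̂, χ₁)` is an equivariant CY structure for it
    (∀ (EG HG G : Type*) [NormedAddCommGroup EG] [NormedSpace ℂ EG] [FiniteDimensional ℂ EG]
      [TopologicalSpace HG] (IG : ModelWithCorners ℂ EG HG) [IG.Boundaryless]
      [TopologicalSpace G] [ChartedSpace HG G] [Group G] [LieGroup IG ω G] (a : G →* AutX d X),
      ContMDiff (IG.prod 𝓘(ℂ, Fin d → ℂ)) 𝓘(ℂ, Fin d → ℂ) ω (fun p : G × X => a p.1 p.2) →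
      IsHolomorphicAction (IK d) IG (fun g : G => autKX (a g)) ∧
      IsEquivariantCYStructure (IK d) 𝓘(ℂ, Fin d → ℂ) 𝓘(ℂ, ℂ) (projKX (d := d) (X := X)) actKX
        (fun g : G => autKX (a g)) (fun g x => a g x) canonicalFormKX (MonoidHom.id ℂˣ)) ∧
    -- `ι_{x₀} ω̂` is a holomorphic, `Aut X`-invariant and `ℂˣ`-horizontal `d`-form on `K_X^×`
    IsHolomorphicForm (IK d) (contract (IK d) x₀ (canonicalFormKX (d := d) (X := X))) ∧
    (∀ g : AutX d X, Γ (IK d) autKX g (contract (IK d) x₀ canonicalFormKX) =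
      contract (IK d) x₀ canonicalFormKX) ∧
    (∀ (a : ℂ) (η : KX d X) (v : Fin d → TangentSpace (IK d) η),
      (∃ i, v i = generatedField (IK d) actKX a η) →
      contract (IK d) x₀ canonicalFormKX η v = 0) ∧
    -- `ι_{x₀} ω̂ = z_w dw₁ ∧ ⋯ ∧ dw_d` in every holomorphic chart `w` of `X`
    (∀ w ∈ IsManifold.maximalAtlas 𝓘(ℂ, Fin d → ℂ) ω X, ∀ η : KX d X, projKX η ∈ w.source →
      contract (IK d) x₀ canonicalFormKX η =
        fibreCoord w η.1 • dWedge (IK d) (fun i (ξ : KX d X) => w (projKX ξ) i) η) := by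
  refine ⟨fun w hw η h => canonicalForm_eq_localForm hw η h, isHolomorphicForm_canonicalForm,
    canonicalForm_ne_zero, fun g => funext fun η => pullback_autK_canonicalForm g⁻¹ η,
    fun h => funext fun η => ?_,
    -- `Aut X` acts through the identity homomorphism.
    isEquivariantCYStructure_canonicalFormKX (MonoidHom.id (AutX d X)), ?_,
    isHolomorphicForm_contract, fun g => funext fun η => pullback_autKX_contract g⁻¹ η,
    contract_canonicalFormKX_horizontal, fun w hw η h => contract_canonicalFormKX hw η h⟩
  · refine (pullback_actK_canonicalForm h⁻¹ η).trans ?_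
    rw [inv_inv]
  · intro EG HG G _ _ _ _ IG _ _ _ _ _ a ha
    have : IsManifold IG 1 G := IsManifold.of_le (n := ω) (by simp)
    exact ⟨isHolomorphicAction_autKX a ha, isEquivariantCYStructure_canonicalFormKX a⟩
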